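/- **Theorem 1 ($\ell_1$-Toeplitz matrix representation of the coverage probability).** Let $M\ge 1$ be an integer and let $\theta>0$, $\alpha>0$, $\gamma>0$, $\sigma_{\mathrm n}^2\ge 0$. A typical receiver sits at the origin of $\mathbb R^2$. Its associated transmitter is at a random point $x_0$, and $r_0=\|x_0\|$ has a probability density $f_{r_0}$. There are finitely many types $j$ of interferers. Conditionally on $x_0$, the interferers of the different types form independent Poisson point processes $\Phi'_j$ on $\mathbb R^2$ with locally finite intensity measures $\Lambda_{j}^{x_0}$ (for instance $\lambda_{\mathrm t,j}\,\mathrm dx$ on a region depending on $x_0$). Given all locations, the interference gains $g_x\ge 0$ are independent, the gain of an interferer of type $j$ at $x$ having an arbitrary distribution that depends on $j$ and $x$ only; a random variable with this distribution is denoted $g_{x,j}$. The signal gain $g_{x_0}$ is $\mathrm{Gamma}(M,\theta)$ distributed (shape $M$, scale $\theta$) and independent of all locations and interference gains. Let $$\mathrm{SINR}=\frac{g_{x_0}r_0^{-\alpha}}{\sigma_{\mathrm n}^2+I},\qquad I=\sum_j\sum_{x\in\Phi'_j}g_x\|x\|^{-\alpha},\qquad p_{\mathrm c}(\gamma)=\mathbb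 P(\mathrm{SINR}>\gamma),$$ where $a/0=\infty$ for $a>0$. Assume that $I<\infty$ almost surely and that for all $s>0$ the quantity $$\eta(s)=-s\sigma_{\mathrm n}^2-\sum_j\int_{\mathbb R^2}\Bigl(1-\mathbb E\bigl[e^{-s\,g_{x,j}\|x\|^{-\alpha}}\bigr]\Bigr)\,\Lambda_{j}^{x_0}(\mathrm dx)$$ depends on $x_0$ only through $r_0=\|x_0\|$; write $\eta=\eta_r$ when $r_0=r$. Then, almost surely, $\eta_{r_0}$ is finite and infinitely differentiable on $(0,\infty)$; for every $s>0$, almost surely, $\mathbb E[e^{-s(\sigma_{\mathrm n}^2+I)}\mid x_0]=e^{\eta_{r_0}(s)}$; and $$p_{\mathrm c}(\gamma)=\int_0^\infty f_{r_0}(r)\,\bigl\|\exp\{\mathbf Q_M(r)\}\bigr\|_1\,\mathrm dr,$$ the integrand being integrable. Here $\mathbf Q_M(r)$ is the $M\times M$ lower triangular Toeplitz matrix with $(i,j)$ entry $q_{i-j}$ for $i\ge j$ and $0$ for $i<j$, where $$q_k=\frac{(-s)^k}{k!}\,\eta_r^{(k)}(s),\qquad s=\frac{\gamma r^\alpha}{\theta},$$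 $\exp$ is the matrix exponential, and $\|\cdot\|_1$ is the matrix norm induced by the $\ell_1$ norm on $\mathbb R^M$. -/

import Mathlib

open MeasureTheory ProbabilityTheory Set Filter
open scoped ENNReal NNReal Nat

noncomputable section

/-- The plane in which the transmitters are located; the typical receiver is at the origin. -/
abbrev Plane : Type := EuclideanSpace ℝ (Fin 2)

/-- The part of a downlink network seen from the typical receiver at the origin, on a probability
space `(Ω, P)`.

* `X0` is the location of the associated transmitter and `g0 ∼ Gamma(M, θ)` (shape `M`, scale `θ`)
  the signal channel gain.
* There are finitely many types `j : J` of interferers. The interferers of type `j` are the points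
  `loc j n`, `n < num j` (a random, possibly infinite, number of points, enumerated measurably),
  and `loc j n` has the channel gain `gain j n`. (The values of `loc j n` and `gain j n` for
  `n ≥ num j` are irrelevant.)
* Conditionally on `X0 = x`, the interferers of the various types form independent Poisson point
  processes with the locally finite intensity measures `intensity j x`. For a homogeneous process
  of density `lam` in a region `A x`, the intensity measure is `lam` times Lebesgue measure
  restricted to `A x`.
* Given all locations, the interference gains are independent, and the gain of an interferer of
  type `j` at `y` has the distribution `gainLaw j y`, an arbitrary distribution on `[0, ∞)`.
* The signal gain is independent of all locations and of all interference gains. -/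
structure PPPNetwork {Ω : Type*} [MeasurableSpace Ω] (P : Measure Ω) (J : Type*) [Fintype J]
    (M : ℕ) (θ : ℝ) where
  /-- location of the associated transmitter -/
  X0 : Ω → Plane
  /-- signal channel gain -/
  g0 : Ω → ℝ
  /-- number of interferers of each type -/
  num : J → Ω → ℕ∞
  /-- locations of the interferers of each type -/
  loc : J → ℕ → Ω → Plane
  /-- channel gains of the interferers of each type -/
  gain : J → ℕ → Ω → ℝ≥0
  /-- intensity measures of the interferers of each type, given the location of the associated
  transmitter -/
  intensity : J → Kernel Plane Plane
  /-- distribution of the gain of an interferer of each type, given its location -/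
  gainLaw : J → Kernel Plane ℝ≥0
  measurable_X0 : Measurable X0
  measurable_g0 : Measurable g0
  measurable_num : ∀ j, Measurable (num j)
  measurable_loc : ∀ j n, Measurable (loc j n)
  measurable_gain : ∀ j n, Measurable (gain j n)
  locallyFinite_intensity : ∀ j x, IsLocallyFiniteMeasure (intensity j x)
  isMarkovKernel_gainLaw : ∀ j, IsMarkovKernel (gainLaw j)
  /-- Given `X0`, the numbers of interferers of the various types in disjoint bounded regions are
  independent Poisson variables with means given by the intensity measures. -/
  poisson : ∀ (A : Set Plane), MeasurableSet A →
    ∀ (m : ℕ) (B : J → Fin m → Set Plane),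
    (∀ j i, MeasurableSet (B j i)) → (∀ j i, Bornology.IsBounded (B j i)) →
    (∀ j, Pairwise fun i i' => Disjoint (B j i) (B j i')) →
    ∀ k : J → Fin m → ℕ,
    P {ω | X0 ω ∈ A ∧
        ∀ j i, {n : ℕ | (n : ℕ∞) < num j ω ∧ loc j n ω ∈ B j i}.encard = (k j i : ℕ∞)} =
      ∫⁻ x in A, ∏ j, ∏ i, poissonMeasure (intensity j x (B j i)).toNNReal {k j i} ∂(P.map X0)
  /-- Given `X0` and all the interferers' locations, the interference gains are independent with the
  distributions `gainLaw`. -/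
  gain_law : ∀ (H : Set (Plane × (J → ℕ∞) × (J → ℕ → Plane))), MeasurableSet H →
    ∀ (S : Finset (J × ℕ)) (C : J × ℕ → Set ℝ≥0), (∀ p, MeasurableSet (C p)) →
    P {ω | (X0 ω, (fun j => num j ω), (fun j n => loc j n ω)) ∈ H ∧
        ∀ p ∈ S, gain p.1 p.2 ω ∈ C p} =
      ∫⁻ ω in {ω | (X0 ω, (fun j => num j ω), (fun j n => loc j n ω)) ∈ H},
        ∏ p ∈ S, gainLaw p.1 (loc p.1 p.2 ω) (C p) ∂P
  /-- The signal gain is `Gamma(M, θ)` distributed (Mathlib uses the rate, not the scale). -/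
  g0_law : P.map g0 = gammaMeasure M θ⁻¹
  g0_indep : IndepFun g0
    (fun ω => (X0 ω, (fun j => num j ω), (fun j n => loc j n ω), (fun j n => gain j n ω))) P

namespace PPPNetwork

variable {Ω : Type*} [MeasurableSpace Ω] {P : Measure Ω} {J : Type*} [Fintype J] {M : ℕ} {θ : ℝ}

/-- The aggregate interference `I = ∑ g_x ‖x‖^(-α)`, a sum over all interferers, in `[0, ∞]`. -/
def interference (N : PPPNetwork P J M θ) (α : ℝ) (ω : Ω) : ℝ≥0∞ :=
  ∑ j, ∑' n : ℕ, if (n : ℕ∞) < N.num j ω then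
    (N.gain j n ω : ℝ≥0∞) * ‖N.loc j n ω‖ₑ ^ (-α) else 0

/-- The SINR `g_{x₀} r₀^(-α) / (noise + I)`, in `[0, ∞]`, where `r₀ = ‖x₀‖` and `noise` is the noise
power. -/
def sinr (N : PPPNetwork P J M θ) (α noise : ℝ) (ω : Ω) : ℝ≥0∞ :=
  ENNReal.ofReal (N.g0 ω * ‖N.X0 ω‖ ^ (-α)) / (ENNReal.ofReal noise + N.interference α ω)

/-- The coverage probability `ℙ(SINR > γ)`. -/
def coverageProb (N : PPPNetwork P J M θ) (α noise γ : ℝ) : ℝ :=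
  P.real {ω | ENNReal.ofReal γ < N.sinr α noise ω}

/-- The term `∑_j ∫ (1 - 𝔼[exp(-s g_{y,j} ‖y‖^(-α))]) Λ_j(dy)` in `[0, ∞]`, where `Λ_j` are the
intensity measures given that the associated transmitter is at `x`. -/
def interferenceExponent (N : PPPNetwork P J M θ) (α : ℝ) (x : Plane) (s : ℝ) : ℝ≥0∞ :=
  ∑ j, ∫⁻ y, ENNReal.ofReal
    (1 - ∫ g : ℝ≥0, Real.exp (-s * (g : ℝ) * ‖y‖ ^ (-α)) ∂(N.gainLaw j y)) ∂(N.intensity j x)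

/-- The exponent `η(s)` of the Laplace transform of noise plus interference, given that the
associated transmitter is at distance `r` from the receiver (evaluated at the point `(r, 0)`). -/
def eta (N : PPPNetwork P J M θ) (α noise r s : ℝ) : ℝ :=
  -s * noise - (N.interferenceExponent α (EuclideanSpace.single 0 r) s).toReal

end PPPNetwork

/-- `q_k = (-s)^k / k! * η^{(k)}(s)`. -/
def toeplitzCoeff (η : ℝ → ℝ) (s : ℝ) (k : ℕ) : ℝ :=
  (-s) ^ k / (k ! : ℝ) * iteratedDeriv k η s

/-- The `M × M` lower triangular Toeplitz matrix with first column `q 0, …, q (M - 1)`. -/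
def lowerToeplitz (M : ℕ) (q : ℕ → ℝ) : Matrix (Fin M) (Fin M) ℝ :=
  Matrix.of fun i j => if j ≤ i then q ((i : ℕ) - (j : ℕ)) else 0

/-- The matrix norm induced by the `ℓ¹` norm on `ℝ^M`: the operator norm of `v ↦ A v`. -/
def inducedL1Norm {M : ℕ} (A : Matrix (Fin M) (Fin M) ℝ) : ℝ :=
  ‖LinearMap.toContinuousLinearMap (Matrix.toLpLin 1 1 A)‖

end

/-! Let V be noise plus interference and s = γ r^α / θ. Given r₀ = r and V = v, coverage means that
the signal gain exceeds γ r^α v. For integer shape the Gamma tail is a truncated Poisson sum, so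
this has probability ∑_{k<M} (sv)^k/k! · e^{-sv}. Averaging over V gives ∑_{k<M} p_k, where p_k =
(-s)^k/k! · L^{(k)}(s) and L = e^η is the conditional Laplace transform of V. The p_k are scaled
Taylor coefficients of e^η, as the q_k are of η. Hence ∑ p_k z^k = exp(∑ q_k z^k), and the
truncation of power series to Toeplitz matrices preserves products, so exp Q_M has first column p_0,
…, p_{M-1}. Its entries are nonnegative, so its ℓ¹ norm is the sum of that column
(`exp_lowerToeplitz`, `inducedL1Norm_exp_lowerToeplitz`).

The probabilistic half is L = e^η. Poisson generating functions give the Laplace functional for step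
functions, hence for all measurable functions (`lintegral_expNeg_loc`). Averaging the gains given
the locations replaces each received power by a function of its location
(`lintegral_expNeg_interference`). Everything takes values in [0, ∞] with e^{-∞} = 0, so no
convergence is presupposed; finiteness of η follows afterwards from that of I. The identity holds
for almost every r at each fixed s. Continuity of L and monotonicity of η make the null set
independent of s, and η = log L is then analytic. -/

/-! ### Toeplitz matrices as truncated power series -/

theorem lowerToeplitz_mul (M : ℕ) (p q : PowerSeries ℝ) :
    lowerToeplitz M (fun k => PowerSeries.coeff k (p * q)) =
      lowerToeplitz M (fun k => PowerSeries.coeff k p) *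
        lowerToeplitz M (fun k => PowerSeries.coeff k q) := by
  ext i j
  simp only [lowerToeplitz, Matrix.mul_apply, Matrix.of_apply, PowerSeries.coeff_mul]
  split_ifs with h
  · rw [Finset.Nat.sum_antidiagonal_eq_sum_range_succ
      (fun a b => PowerSeries.coeff a p * PowerSeries.coeff b q)]
    symm
    rw [← Finset.sum_subset (Finset.subset_univ (Finset.Icc j i))]
    · refine Finset.sum_bij (fun l _ => (i : ℕ) - l) ?_ ?_ ?_ ?_
      · intro l hl
        simp only [Finset.mem_Icc, Fin.le_def] at hl
        simp only [Finset.mem_range]; omega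
      · intro l hl l' hl' e
        simp only [Finset.mem_Icc, Fin.le_def] at hl hl'
        ext; omega
      · intro b hb
        simp only [Finset.mem_range] at hb
        refine ⟨⟨i - b, by omega⟩, ?_, ?_⟩
        · simp only [Finset.mem_Icc, Fin.le_def]; omega
        · simp only; omega
      · intro l hl
        have hl2 := Finset.mem_Icc.1 hl
        rw [if_pos hl2.2, if_pos hl2.1]
        have h1 := Fin.le_def.1 hl2.1
        have h2 := Fin.le_def.1 hl2.2
        congr 3
        omega
    · intro l _ hl
      simp only [Finset.mem_Icc, not_and_or] at hl
      rcases hl with hl | hl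
      · rw [if_neg hl, mul_zero]
      · rw [if_neg hl, zero_mul]
  · refine (Finset.sum_eq_zero fun l _ => ?_).symm
    by_cases h1 : l ≤ i
    · rw [if_neg (fun h2 : j ≤ l => h (h2.trans h1)), mul_zero]
    · rw [if_neg h1, zero_mul]

theorem lowerToeplitz_pow (M : ℕ) (q : PowerSeries ℝ) (n : ℕ) :
    lowerToeplitz M (fun k => PowerSeries.coeff k q) ^ n =
      lowerToeplitz M (fun k => PowerSeries.coeff k (q ^ n)) := by
  induction n with
  | zero =>
    ext i j
    simp only [pow_zero, lowerToeplitz, Matrix.of_apply, PowerSeries.coeff_one, Matrix.one_apply]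
    by_cases h : i = j
    · simp [h]
    · rw [if_neg h]
      split_ifs with h1 h2
      · exact absurd (Fin.ext (by have := Fin.le_def.1 h1; omega)) h
      · rfl
      · rfl
  | succ n ih => rw [pow_succ, ih, pow_succ, lowerToeplitz_mul]

theorem hasSum_exp_matrix {M : ℕ} (A : Matrix (Fin M) (Fin M) ℝ) (i j : Fin M) :
    HasSum (fun n : ℕ => (n ! : ℝ)⁻¹ * (A ^ n) i j) (NormedSpace.exp A i j) := by
  let : NormedRing (Matrix (Fin M) (Fin M) ℝ) := Matrix.linftyOpNormedRing
  let : NormedAlgebra ℝ (Matrix (Fin M) (Fin M) ℝ) := Matrix.linftyOpNormedAlgebra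
  have h := NormedSpace.exp_series_hasSum_exp' (𝕂 := ℝ) A
  exact (Pi.hasSum.1 ((Pi.hasSum.1 h) i)) j

/-- The exponential of a lower triangular Toeplitz matrix with first column `q` is the lower
triangular Toeplitz matrix of the power series `exp q`. -/
theorem exp_lowerToeplitz {M : ℕ} (q p : ℕ → ℝ) (h0 : p 0 = Real.exp (q 0))
    (hrec : ∀ k : ℕ, ((k : ℝ) + 1) * p (k + 1) =
      ∑ x ∈ Finset.HasAntidiagonal.antidiagonal k, p x.1 * (((x.2 : ℝ) + 1) * q (x.2 + 1))) :
    NormedSpace.exp (lowerToeplitz M q) = lowerToeplitz M p := by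
  set Q : PowerSeries ℝ := PowerSeries.mk q with hQ
  have hqQ : q = fun k => PowerSeries.coeff k Q := by ext k; simp [hQ]
  -- The coefficients of ∑ Qⁿ/n! are found by strong induction: (Qⁿ⁺¹/(n+1)!)' = (Qⁿ/n!) Q' gives
  -- them the recurrence `hrec`.
  have key : ∀ k, k < M →
      HasSum (fun n : ℕ => (n ! : ℝ)⁻¹ * PowerSeries.coeff k (Q ^ n)) (p k) := by
    intro k
    induction k using Nat.strong_induction_on with
    | _ k ih =>
      intro hk
      cases k with
      | zero =>
        rw [h0]
        have h := NormedSpace.exp_series_hasSum_exp' (𝕂 := ℝ) (q 0)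
        rw [← Real.exp_eq_exp_ℝ] at h
        have hfun : (fun n : ℕ => (n ! : ℝ)⁻¹ * PowerSeries.coeff 0 (Q ^ n)) =
            fun n : ℕ => (n ! : ℝ)⁻¹ • q 0 ^ n := by
          funext n
          simp [hQ]
        rw [hfun]
        exact h
      | succ k =>
        have h1 : HasSum (fun n : ℕ => (n ! : ℝ)⁻¹ * PowerSeries.coeff k
            (Q ^ n * PowerSeries.derivative ℝ Q)) (((k : ℝ) + 1) * p (k + 1)) := by
          rw [hrec]
          simp only [PowerSeries.coeff_mul, Finset.mul_sum]
          refine hasSum_sum fun x hx => ?_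
          have hx' := Finset.HasAntidiagonal.mem_antidiagonal.1 hx
          have := (ih x.1 (by omega) (by omega)).mul_right (((x.2 : ℝ) + 1) * q (x.2 + 1))
          refine this.congr_fun fun n => ?_
          simp only [hQ, PowerSeries.coeff_derivative, PowerSeries.coeff_mk]
          ring
        have h2 : ∀ n : ℕ, (n ! : ℝ)⁻¹ * PowerSeries.coeff k (Q ^ n * PowerSeries.derivative ℝ Q)
            = ((k : ℝ) + 1) * (((n + 1)! : ℝ)⁻¹ * PowerSeries.coeff (k + 1) (Q ^ (n + 1))) := by
          intro n
          have h3 := PowerSeries.coeff_derivative (Q ^ (n + 1)) k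
          rw [Derivation.leibniz_pow] at h3
          simp only [Nat.add_sub_cancel, smul_eq_mul, nsmul_eq_mul] at h3
          rw [← map_natCast (PowerSeries.C (R := ℝ)), PowerSeries.coeff_C_mul] at h3
          rw [mul_left_comm, mul_comm ((k : ℝ) + 1), ← h3, Nat.factorial_succ]
          push_cast
          have : ((n : ℝ) + 1) ≠ 0 := by positivity
          field_simp
        simp only [h2] at h1
        have hk1 : ((k : ℝ) + 1) ≠ 0 := by positivity
        have h4 := h1.mul_left ((k : ℝ) + 1)⁻¹
        simp only [inv_mul_cancel_left₀ hk1] at h4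
        -- The term n = 0 is lost in differentiation, but the coefficient k + 1 of Q⁰ = 1 is zero.
        rw [hasSum_nat_add_iff' (f := fun n : ℕ =>
          (n ! : ℝ)⁻¹ * PowerSeries.coeff (k + 1) (Q ^ n)) 1 |>.symm]
        simpa [PowerSeries.coeff_one] using h4
  ext i j
  refine (hasSum_exp_matrix _ i j).unique ?_
  simp only [hqQ, lowerToeplitz_pow]
  simp only [lowerToeplitz, Matrix.of_apply]
  split_ifs with h
  · exact key _ (by omega)
  · simp

/-- The norm induced by ℓ¹ is the largest absolute column sum. Here the entries are nonnegative and
each column is an initial piece of the first one, shifted down, so the first column is the largest.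
-/
theorem inducedL1Norm_lowerToeplitz {M : ℕ} (hM : 0 < M) (p : ℕ → ℝ) (hp : ∀ k, 0 ≤ p k) :
    inducedL1Norm (lowerToeplitz M p) = ∑ k ∈ Finset.range M, p k := by
  have hnorm : ∀ v : PiLp 1 (fun _ : Fin M => ℝ), ‖v‖ = ∑ i, |v i| := fun v => by
    simp [PiLp.norm_eq_of_L1]
  have happ : ∀ (v : PiLp 1 (fun _ : Fin M => ℝ)) (i : Fin M),
      (LinearMap.toContinuousLinearMap (Matrix.toLpLin 1 1 (lowerToeplitz M p)) v) i =
        ∑ j, (if j ≤ i then p ((i : ℕ) - j) else 0) * v j := fun v i => by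
    simp [Matrix.toLpLin_apply, lowerToeplitz, Matrix.mulVec, dotProduct]
  have hcol : ∀ j : Fin M, ∑ i : Fin M, (if j ≤ i then p ((i : ℕ) - j) else 0) ≤
      ∑ k ∈ Finset.range M, p k := by
    intro j
    rw [← Finset.sum_filter]
    have : ∑ i ∈ Finset.univ.filter (fun i : Fin M => j ≤ i), p ((i : ℕ) - j) =
        ∑ k ∈ (Finset.univ.filter (fun i : Fin M => j ≤ i)).image (fun i : Fin M => (i : ℕ) - j),
          p k := by
      rw [Finset.sum_image]
      intro a ha b hb e
      simp only [Finset.coe_filter, Finset.mem_univ, true_and, mem_ofPred_eq, Fin.le_def] at ha hb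
      ext
      simp only at e
      omega
    rw [this]
    refine Finset.sum_le_sum_of_subset_of_nonneg ?_ fun k _ _ => hp k
    intro k hk
    simp only [Finset.mem_image, Finset.mem_filter, Finset.mem_univ, true_and] at hk
    obtain ⟨a, -, rfl⟩ := hk
    simp only [Finset.mem_range]; omega
  have hif : ∀ i j : Fin M, 0 ≤ (if j ≤ i then p ((i : ℕ) - j) else 0) := fun i j => by
    split_ifs
    · exact hp _
    · exact le_rfl
  refine le_antisymm ?_ ?_
  · refine ContinuousLinearMap.opNorm_le_bound _ (Finset.sum_nonneg fun k _ => hp k) fun v => ?_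
    rw [hnorm, hnorm, Finset.mul_sum]
    simp only [happ]
    calc ∑ i : Fin M, |∑ j, (if j ≤ i then p ((i : ℕ) - j) else 0) * v j|
        ≤ ∑ i : Fin M, ∑ j, (if j ≤ i then p ((i : ℕ) - j) else 0) * |v j| := by
          refine Finset.sum_le_sum fun i _ => (Finset.abs_sum_le_sum_abs _ _).trans ?_
          refine Finset.sum_le_sum fun j _ => ?_
          rw [abs_mul, abs_of_nonneg (hif i j)]
      _ = ∑ j, (∑ i : Fin M, (if j ≤ i then p ((i : ℕ) - j) else 0)) * |v j| := by
          rw [Finset.sum_comm]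
          simp only [Finset.sum_mul]
      _ ≤ _ := Finset.sum_le_sum fun j _ => mul_le_mul_of_nonneg_right (hcol j) (abs_nonneg _)
  -- The first basis vector, available since M > 0, attains the bound.
  · have := (LinearMap.toContinuousLinearMap (Matrix.toLpLin 1 1 (lowerToeplitz M p))).le_opNorm
      (WithLp.toLp 1 (Pi.single (⟨0, hM⟩ : Fin M) (1 : ℝ)))
    rw [hnorm, hnorm] at this
    simp only [happ] at this
    simp only [Pi.single_apply, mul_ite, mul_one, mul_zero, Finset.sum_ite_eq', Finset.mem_univ,
      if_true, apply_ite abs, abs_zero, abs_one] at this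
    rw [← Fin.sum_univ_eq_sum_range]
    refine (Finset.sum_le_sum fun i _ => ?_).trans this
    rw [if_pos (Fin.le_def.2 (Nat.zero_le _))]
    exact le_abs_self _

/-! ### Tail of the Gamma distribution with integer shape -/

/-- An antiderivative of the density with shape n + 1 and rate r: the derivatives of the summands
telescope, leaving the last term. -/
theorem hasDerivAt_exp_mul_sum_pow (r x : ℝ) (n : ℕ) :
    HasDerivAt (fun x => -∑ k ∈ Finset.range (n + 1), (r * x) ^ k / (k ! : ℝ) * Real.exp (-(r * x)))
      (r * ((r * x) ^ n / (n ! : ℝ) * Real.exp (-(r * x)))) x := by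
  have hlin : HasDerivAt (fun x => r * x) r x := by simpa using (hasDerivAt_id x).const_mul r
  have hexp : HasDerivAt (fun x => Real.exp (-(r * x))) (Real.exp (-(r * x)) * -r) x :=
    hlin.neg.exp
  induction n with
  | zero =>
    simp only [zero_add, Finset.range_one, Finset.sum_singleton, pow_zero, Nat.factorial_zero,
      Nat.cast_one, div_one, one_mul]
    exact hexp.fun_neg.congr_deriv (by ring)
  | succ n ih =>
    have h1 : HasDerivAt (fun x => (r * x) ^ (n + 1) / ((n + 1)! : ℝ) * Real.exp (-(r * x)))
        ((((n + 1 : ℕ) : ℝ) * (r * x) ^ n * r) / ((n + 1)! : ℝ) * Real.exp (-(r * x)) +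
          (r * x) ^ (n + 1) / ((n + 1)! : ℝ) * (Real.exp (-(r * x)) * -r)) x :=
      ((hlin.fun_pow (n + 1)).div_const ((n + 1)! : ℝ)).fun_mul hexp
    have h2 := ih.fun_sub h1
    simp only [← neg_add', ← Finset.sum_range_succ (fun k => (r * _) ^ k / (k ! : ℝ) *
      Real.exp (-(r * _)))] at h2
    refine h2.congr_deriv ?_
    rw [Nat.factorial_succ]
    have : ((n : ℝ) + 1) ≠ 0 := by positivity
    push_cast
    field_simp
    ring

theorem gammaMeasure_Ioi {M : ℕ} (hM : 0 < M) {r : ℝ} (hr : 0 < r) {x : ℝ} (hx : 0 ≤ x) :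
    gammaMeasure M r (Ioi x) =
      ENNReal.ofReal (∑ k ∈ Finset.range M, (r * x) ^ k / (k ! : ℝ) * Real.exp (-(r * x))) := by
  obtain ⟨n, rfl⟩ : ∃ n, M = n + 1 := ⟨M - 1, by omega⟩
  have hlim : Tendsto (fun x => -∑ k ∈ Finset.range (n + 1),
      (r * x) ^ k / (k ! : ℝ) * Real.exp (-(r * x))) atTop (nhds 0) := by
    rw [show (0 : ℝ) = -∑ k ∈ Finset.range (n + 1), 0 by simp]
    refine (tendsto_finsetSum _ fun k _ => ?_).neg
    have h1 := (Real.tendsto_pow_mul_exp_neg_atTop_nhds_zero k).comp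
      (tendsto_id.const_mul_atTop hr)
    have h2 := h1.div_const (k ! : ℝ)
    simp only [zero_div] at h2
    refine h2.congr fun y => ?_
    simp only [Function.comp, id]
    ring
  have hpos : ∀ y ∈ Ioi x, 0 ≤ r * ((r * y) ^ n / (n ! : ℝ) * Real.exp (-(r * y))) := by
    intro y hy
    have : 0 ≤ y := hx.trans (le_of_lt hy)
    positivity
  have hint := integral_Ioi_of_hasDerivAt_of_nonneg'
    (fun y _ => hasDerivAt_exp_mul_sum_pow r y n) hpos hlim
  have hio := integrableOn_Ioi_deriv_of_nonneg'
    (fun y _ => hasDerivAt_exp_mul_sum_pow r y n) hpos hlim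
  rw [zero_sub, neg_neg] at hint
  rw [← hint, ofReal_integral_eq_lintegral_ofReal hio
    ((ae_restrict_iff' measurableSet_Ioi).2 (ae_of_all _ hpos)), gammaMeasure,
    withDensity_apply _ measurableSet_Ioi]
  refine setLIntegral_congr_fun measurableSet_Ioi fun y hy => ?_
  have hy0 : 0 ≤ y := hx.trans (le_of_lt hy)
  rw [gammaPDF_of_nonneg hy0]
  congr 1
  have h1 : ((n + 1 : ℕ) : ℝ) - 1 = (n : ℝ) := by push_cast; ring
  rw [h1, Real.rpow_natCast, Real.rpow_natCast, Nat.cast_succ, Real.Gamma_nat_eq_factorial]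
  ring

/-! ### Laplace transforms on the half-line and their Taylor coefficients -/

section Laplace

variable {κ : Measure ℝ} [IsProbabilityMeasure κ]

/-- For t < 0 and v ≥ 0 the integrand e^{tv} is at most 1. In the interior of its domain the moment
generating function is analytic and may be differentiated under the integral. -/
theorem Iio_zero_subset_interior_integrableExpSet (hκ : ∀ᵐ v ∂κ, 0 ≤ v) :
    Iio 0 ⊆ interior (integrableExpSet id κ) := by
  refine interior_maximal (fun t ht => ?_) isOpen_Iio
  refine Integrable.mono' (integrable_const (1 : ℝ)) (by fun_prop) ?_
  filter_upwards [hκ] with v hv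
  rw [Real.norm_of_nonneg (Real.exp_nonneg _), Real.exp_le_one_iff]
  exact mul_nonpos_of_nonpos_of_nonneg (le_of_lt ht) hv

theorem analyticAt_laplace (hκ : ∀ᵐ v ∂κ, 0 ≤ v) {s : ℝ} (hs : 0 < s) :
    AnalyticAt ℝ (fun s => mgf id κ (-s)) s := by
  have h := analyticAt_mgf (Iio_zero_subset_interior_integrableExpSet hκ
    (show -s ∈ Iio 0 by simpa using hs))
  exact h.comp_of_eq analyticAt_id.neg rfl

theorem iteratedDeriv_laplace (hκ : ∀ᵐ v ∂κ, 0 ≤ v) {s : ℝ} (hs : 0 < s) (k : ℕ) :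
    iteratedDeriv k (fun s => mgf id κ (-s)) s = (-1) ^ k * ∫ v, v ^ k * Real.exp (-s * v) ∂κ := by
  have h := iteratedDeriv_mgf (Iio_zero_subset_interior_integrableExpSet hκ
    (show -s ∈ Iio 0 by simpa using hs)) k
  rw [iteratedDeriv_comp_neg, h, smul_eq_mul]
  rfl

theorem integrable_pow_mul_exp_neg (hκ : ∀ᵐ v ∂κ, 0 ≤ v) {s : ℝ} (hs : 0 < s) (k : ℕ) :
    Integrable (fun v => v ^ k * Real.exp (-s * v)) κ :=
  integrable_pow_mul_exp_of_mem_interior_integrableExpSet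
    (Iio_zero_subset_interior_integrableExpSet hκ (show -s ∈ Iio 0 by simpa using hs)) k

variable {η : ℝ → ℝ}

/-- Since η is the logarithm of a positive analytic function, the integral that defines it never has
to be differentiated. -/
theorem analyticAt_of_exp_eq_laplace (hκ : ∀ᵐ v ∂κ, 0 ≤ v)
    (hη : ∀ s, 0 < s → ∫ v, Real.exp (-s * v) ∂κ = Real.exp (η s)) {s : ℝ} (hs : 0 < s) :
    AnalyticAt ℝ η s := by
  have hmgf : ∀ s, 0 < s → mgf id κ (-s) = Real.exp (η s) := fun s hs => hη s hs
  have h := (analyticAt_laplace hκ hs).log (by rw [hmgf s hs]; exact Real.exp_pos _)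
  refine h.congr ?_
  filter_upwards [Ioi_mem_nhds hs] with t ht
  rw [hmgf t ht, Real.log_exp]

/-- The Leibniz rule applied to (e^η)' = e^η η', rescaled by powers of -s and factorials; this is
the hypothesis `hrec` of `exp_lowerToeplitz`. -/
theorem toeplitz_recurrence {s : ℝ} (hη : AnalyticAt ℝ η s) (k : ℕ) :
    ((k : ℝ) + 1) * toeplitzCoeff (fun t => Real.exp (η t)) s (k + 1) =
      ∑ x ∈ Finset.HasAntidiagonal.antidiagonal k,
        toeplitzCoeff (fun t => Real.exp (η t)) s x.1 *
          (((x.2 : ℝ) + 1) * toeplitzCoeff η s (x.2 + 1)) := by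
  have hd : deriv (fun t => Real.exp (η t)) =ᶠ[nhds s] fun t => Real.exp (η t) * deriv η t := by
    filter_upwards [hη.eventually_analyticAt] with t ht
    exact ht.differentiableAt.hasDerivAt.exp.deriv
  have hL : AnalyticAt ℝ (fun t => Real.exp (η t)) s := hη.rexp
  have h1 : iteratedDeriv (k + 1) (fun t => Real.exp (η t)) s =
      ∑ i ∈ Finset.range (k + 1), (k.choose i : ℝ) *
        iteratedDeriv i (fun t => Real.exp (η t)) s * iteratedDeriv (k - i + 1) η s := by
    rw [iteratedDeriv_succ', hd.iteratedDeriv_eq, iteratedDeriv_fun_mul hL.contDiffAt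
      hη.deriv.contDiffAt]
    simp only [iteratedDeriv_succ']
  rw [Finset.Nat.sum_antidiagonal_eq_sum_range_succ (fun a b =>
    toeplitzCoeff (fun t => Real.exp (η t)) s a * (((b : ℝ) + 1) * toeplitzCoeff η s (b + 1)))]
  unfold toeplitzCoeff
  rw [h1, Finset.mul_sum, Finset.mul_sum]
  refine Finset.sum_congr rfl fun i hi => ?_
  have hik : i ≤ k := Nat.lt_succ_iff.1 (Finset.mem_range.1 hi)
  rw [Nat.cast_choose ℝ hik, Nat.factorial_succ, Nat.factorial_succ]
  have h2 : (-s) ^ (k + 1) = (-s) ^ i * (-s) ^ (k - i + 1) := by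
    rw [← pow_add]; congr 1; omega
  rw [h2]
  have hk : ((k : ℝ) + 1) ≠ 0 := by positivity
  have hj : (((k - i : ℕ) : ℝ) + 1) ≠ 0 := by positivity
  push_cast
  field_simp

/-- If `exp η` is the Laplace transform of a probability measure `κ` on `[0, ∞)`, then the
`ℓ¹`-norm of the exponential of the Toeplitz matrix of `η` is a truncated exponential series
averaged over `κ`. -/
theorem inducedL1Norm_exp_lowerToeplitz {M : ℕ} (hM : 0 < M) (hκ : ∀ᵐ v ∂κ, 0 ≤ v)
    (hη : ∀ s, 0 < s → ∫ v, Real.exp (-s * v) ∂κ = Real.exp (η s)) {s : ℝ} (hs : 0 < s) :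
    inducedL1Norm (NormedSpace.exp (lowerToeplitz M (toeplitzCoeff η s))) =
      ∫ v, ∑ k ∈ Finset.range M, (s * v) ^ k / (k ! : ℝ) * Real.exp (-(s * v)) ∂κ := by
  -- The signs (-1)^k from (-s)^k and from the k-th derivative cancel, so each coefficient is an
  -- averaged Poisson weight, in particular nonnegative.
  have hp : ∀ k, toeplitzCoeff (fun t => Real.exp (η t)) s k =
      ∫ v, (s * v) ^ k / (k ! : ℝ) * Real.exp (-(s * v)) ∂κ := by
    intro k
    have he : (fun t => Real.exp (η t)) =ᶠ[nhds s] fun t => mgf id κ (-t) := by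
      filter_upwards [Ioi_mem_nhds hs] with t ht
      exact (hη t ht).symm
    rw [toeplitzCoeff, he.iteratedDeriv_eq, iteratedDeriv_laplace hκ hs, ← mul_assoc,
      ← integral_const_mul]
    congr 1
    funext v
    rw [mul_pow, neg_mul, neg_pow s k]
    have : ((-1 : ℝ) ^ k) * (-1) ^ k = 1 := by rw [← mul_pow]; simp
    linear_combination (s ^ k / (k ! : ℝ) * v ^ k * Real.exp (-(s * v))) * this
  rw [exp_lowerToeplitz _ (toeplitzCoeff (fun t => Real.exp (η t)) s) (by simp [toeplitzCoeff])
    (toeplitz_recurrence (analyticAt_of_exp_eq_laplace hκ hη hs)),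
    inducedL1Norm_lowerToeplitz hM, integral_finsetSum]
  · exact Finset.sum_congr rfl fun k _ => hp k
  · intro k _
    convert (integrable_pow_mul_exp_neg hκ hs k).const_mul (s ^ k / (k ! : ℝ)) using 2 with v
    rw [mul_pow, neg_mul]
    ring
  · intro k
    rw [hp]
    refine integral_nonneg_of_ae ?_
    filter_upwards [hκ] with v hv
    simp only [Pi.zero_apply]
    positivity

end Laplace

/-! ### Exponential and logarithm between [0, ∞] and [0, 1] -/

/-- The function `x ↦ exp (-x)` from `[0, ∞]` to `[0, 1]`. -/
noncomputable def expNeg (x : ℝ≥0∞) : ℝ≥0∞ := EReal.exp (-(x : EReal))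

theorem expNeg_eq_inv (x : ℝ≥0∞) : expNeg x = (EReal.exp (x : EReal))⁻¹ := EReal.exp_neg _

@[simp] theorem expNeg_zero : expNeg 0 = 1 := by simp [expNeg]

@[simp] theorem expNeg_top : expNeg ∞ = 0 := by simp [expNeg]

theorem expNeg_le_one (x : ℝ≥0∞) : expNeg x ≤ 1 := by
  rw [expNeg, EReal.exp_le_one_iff, EReal.neg_le, neg_zero]
  exact EReal.coe_ennreal_nonneg x

theorem expNeg_ne_top (x : ℝ≥0∞) : expNeg x ≠ ∞ :=
  ((expNeg_le_one x).trans_lt ENNReal.one_lt_top).ne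

theorem expNeg_eq_one_iff {x : ℝ≥0∞} : expNeg x = 1 ↔ x = 0 := by
  refine ⟨fun h => ?_, fun h => by simp [h]⟩
  have : 1 ≤ expNeg x := h.ge
  rw [expNeg, EReal.one_le_exp_iff, EReal.neg_nonneg] at this
  have h2 := le_antisymm this (EReal.coe_ennreal_nonneg x)
  exact_mod_cast h2

theorem expNeg_eq_zero_iff {x : ℝ≥0∞} : expNeg x = 0 ↔ x = ∞ := by
  rw [expNeg, EReal.exp_eq_zero_iff, EReal.neg_eq_bot_iff, EReal.coe_ennreal_eq_top_iff]

theorem expNeg_antitone : Antitone expNeg := fun x y h => by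
  rw [expNeg, expNeg, EReal.exp_le_exp_iff, EReal.neg_le_neg_iff]
  exact EReal.coe_ennreal_le_coe_ennreal_iff.2 h

theorem continuous_expNeg : Continuous expNeg :=
  ENNReal.continuous_exp.comp (continuous_neg.comp continuous_coe_ennreal_ereal)

theorem measurable_expNeg : Measurable expNeg := continuous_expNeg.measurable

theorem expNeg_add (x y : ℝ≥0∞) : expNeg (x + y) = expNeg x * expNeg y := by
  have h : ∀ z : ℝ≥0∞, EReal.exp (z : EReal) ≠ 0 := fun z => by
    rw [Ne, EReal.exp_eq_zero_iff]
    exact EReal.coe_ennreal_ne_bot z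
  rw [expNeg_eq_inv, expNeg_eq_inv, expNeg_eq_inv, EReal.coe_ennreal_add, EReal.exp_add,
    ENNReal.mul_inv (Or.inl (h x)) (Or.inr (h y))]

theorem expNeg_sum {ι : Type*} (s : Finset ι) (f : ι → ℝ≥0∞) :
    expNeg (∑ i ∈ s, f i) = ∏ i ∈ s, expNeg (f i) := by
  classical
  induction s using Finset.induction_on with
  | empty => simp
  | insert a s ha ih => rw [Finset.sum_insert ha, Finset.prod_insert ha, expNeg_add, ih]

theorem expNeg_mul_natCast (x : ℝ≥0∞) (n : ℕ) : expNeg (x * n) = expNeg x ^ n := by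
  have := expNeg_sum (Finset.range n) (fun _ => x)
  simpa [mul_comm] using this

theorem expNeg_ofReal {x : ℝ} (hx : 0 ≤ x) :
    expNeg (ENNReal.ofReal x) = ENNReal.ofReal (Real.exp (-x)) := by
  rw [expNeg, EReal.coe_ennreal_ofReal, max_eq_left hx, ← EReal.coe_neg, EReal.exp_coe]

theorem expNeg_eq_ofReal {x : ℝ≥0∞} (hx : x ≠ ∞) :
    expNeg x = ENNReal.ofReal (Real.exp (-x.toReal)) := by
  rw [← expNeg_ofReal ENNReal.toReal_nonneg, ENNReal.ofReal_toReal hx]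

/-- The function `t ↦ max (-log t) 0` on `[0, ∞]`. -/
noncomputable def negLog (t : ℝ≥0∞) : ℝ≥0∞ := (-ENNReal.log t).toENNReal

/-- Any factor in [0, 1] can thus be written as e^{-ψ}, the form required by the Laplace functional;
the factor 0 corresponds to ψ = ∞. -/
theorem expNeg_negLog {t : ℝ≥0∞} (ht : t ≤ 1) : expNeg (negLog t) = t := by
  have h : 0 ≤ -ENNReal.log t := by
    rw [EReal.neg_nonneg, ← ENNReal.log_one]
    exact ENNReal.log_le_log_iff.2 ht
  rw [expNeg, negLog, EReal.coe_toENNReal h, neg_neg, ENNReal.exp_log]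

theorem measurable_negLog : Measurable negLog := by
  unfold negLog
  exact (ENNReal.measurable_log.neg).ereal_toENNReal

/-! ### Generating functions of independent Poisson variables -/

/-- Distributivity for series in [0, ∞], by splitting off one coordinate at a time; it factors sums
over all vectors of counts. -/
theorem tsum_pi_prod {ι κ : Type*} [Fintype ι] (f : ι → κ → ℝ≥0∞) :
    ∑' k : ι → κ, ∏ i, f i (k i) = ∏ i, ∑' x, f i x := by
  have hfin : ∀ (n : ℕ) (f : Fin n → κ → ℝ≥0∞),
      ∑' k : Fin n → κ, ∏ i, f i (k i) = ∏ i, ∑' x, f i x := by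
    intro n
    induction n with
    | zero => intro f; simp
    | succ n ih =>
      intro f
      rw [← (Fin.consEquiv (fun _ : Fin (n + 1) => κ)).tsum_eq, ENNReal.tsum_prod',
        Fin.prod_univ_succ, ← ih, ← ENNReal.tsum_mul_right]
      refine tsum_congr fun x => ?_
      rw [← ENNReal.tsum_mul_left]
      refine tsum_congr fun k => ?_
      simp [Fin.consEquiv, Fin.prod_univ_succ]
  classical
  have e := Fintype.equivFin ι
  have h := hfin _ (fun i => f (e.symm i))
  rw [← (e.arrowCongr (Equiv.refl κ)).tsum_eq] at h
  rw [← e.symm.prod_comp, ← h]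
  refine tsum_congr fun k => ?_
  rw [← e.symm.prod_comp]
  simp

/-- The Poisson generating function e^{-(1-u)r} at u = e^{-c}, where c = ∞, that is u = 0, is
allowed. -/
theorem tsum_pow_mul_poissonMeasure (c : ℝ≥0∞) {r : ℝ≥0∞} (hr : r ≠ ∞) :
    ∑' n : ℕ, expNeg c ^ n * poissonMeasure r.toNNReal {n} = expNeg ((1 - expNeg c) * r) := by
  obtain ⟨u, hu⟩ : ∃ u : ℝ≥0, expNeg c = u := ⟨_, (ENNReal.coe_toNNReal (expNeg_ne_top c)).symm⟩
  lift r to ℝ≥0 using hr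
  have hu1 : (u : ℝ) ≤ 1 := by
    have := expNeg_le_one c
    rw [hu] at this
    exact_mod_cast this
  have h1 : ((1 - expNeg c) * r : ℝ≥0∞) = ENNReal.ofReal ((1 - u) * r) := by
    rw [hu, ENNReal.ofReal_mul (sub_nonneg.2 hu1), ENNReal.ofReal_sub _ u.coe_nonneg,
      ENNReal.ofReal_one]
    simp
  rw [h1, expNeg_ofReal (mul_nonneg (sub_nonneg.2 hu1) r.coe_nonneg), hu]
  have h2 : HasSum (fun n : ℕ => Real.exp (-r) * ((u * r : ℝ) ^ n / (n ! : ℝ)))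
      (Real.exp (-((1 - u) * r))) := by
    have h3 := (NormedSpace.expSeries_div_hasSum_exp (u * r : ℝ)).mul_left (Real.exp (-r))
    rw [← Real.exp_eq_exp_ℝ, ← Real.exp_add] at h3
    rw [show -((1 - u) * r : ℝ) = -r + u * r by ring]
    exact h3
  rw [← h2.tsum_eq, ENNReal.ofReal_tsum_of_nonneg (fun n => by positivity) h2.summable]
  refine tsum_congr fun n => ?_
  rw [poissonMeasure_singleton, ENNReal.toNNReal_coe, ← ENNReal.ofReal_coe_nnreal,
    ← ENNReal.ofReal_pow u.coe_nonneg, ← ENNReal.ofReal_mul (by positivity)]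
  congr 1
  rw [mul_pow]
  ring

theorem measurable_poissonMeasure_singleton (n : ℕ) :
    Measurable fun r : ℝ≥0 => poissonMeasure r {n} := by
  simp only [poissonMeasure_singleton]
  fun_prop

/-! ### Laplace functional of the Poisson processes -/

namespace PPPNetwork

variable {Ω : Type*} [MeasurableSpace Ω] {P : Measure Ω} {J : Type*} [Fintype J] {M : ℕ} {θ : ℝ}

/-- The number of interferers of type `j` in `B`. -/
noncomputable def count (N : PPPNetwork P J M θ) (j : J) (B : Set Plane) (ω : Ω) : ℕ∞ :=
  {n : ℕ | (n : ℕ∞) < N.num j ω ∧ N.loc j n ω ∈ B}.encard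

theorem measurableSet_lt_num (N : PPPNetwork P J M θ) (j : J) (n : ℕ) :
    MeasurableSet {ω | (n : ℕ∞) < N.num j ω} :=
  N.measurable_num j (Set.to_countable (Ioi (n : ℕ∞))).measurableSet

theorem measurable_count (N : PPPNetwork P J M θ) (j : J) {B : Set Plane} (hB : MeasurableSet B) :
    Measurable (N.count j B) := by
  refine measurable_encard.comp (measurable_set_iff.2 fun n => ?_)
  exact measurable_mem.2 ((N.measurableSet_lt_num j n).inter (N.measurable_loc j n hB))

theorem intensity_ne_top (N : PPPNetwork P J M θ) (j : J) (x : Plane) {B : Set Plane}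
    (hB : Bornology.IsBounded B) : N.intensity j x B ≠ ∞ :=
  have := N.locallyFinite_intensity j x
  hB.measure_lt_top.ne

theorem count_eq_tsum (N : PPPNetwork P J M θ) (j : J) (B : Set Plane) (ω : Ω) :
    (N.count j B ω : ℝ≥0∞) =
      ∑' n : ℕ, if (n : ℕ∞) < N.num j ω then B.indicator 1 (N.loc j n ω) else 0 := by
  classical
  rw [count, ← ENNReal.tsum_set_one, tsum_subtype _ (fun _ => (1 : ℝ≥0∞))]
  refine tsum_congr fun n => ?_
  by_cases h1 : (n : ℕ∞) < N.num j ω <;> by_cases h2 : N.loc j n ω ∈ B <;> simp [h1, h2]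

variable [IsProbabilityMeasure P]

/-- The Laplace functional for step functions: split according to the values of the counts and sum
the product of Poisson generating functions. -/
theorem lintegral_expNeg_count (N : PPPNetwork P J M θ) {A : Set Plane} (hA : MeasurableSet A)
    {m : ℕ} (B : J → Fin m → Set Plane) (hB : ∀ j i, MeasurableSet (B j i))
    (hBb : ∀ j i, Bornology.IsBounded (B j i))
    (hBd : ∀ j, Pairwise fun i i' => Disjoint (B j i) (B j i')) (c : J → Fin m → ℝ≥0∞) :
    ∫⁻ ω in N.X0 ⁻¹' A, expNeg (∑ j, ∑ i, c j i * N.count j (B j i) ω) ∂P =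
      ∫⁻ x in A, expNeg (∑ j, ∑ i, (1 - expNeg (c j i)) * N.intensity j x (B j i))
        ∂(P.map N.X0) := by
  set E : (J → Fin m → ℕ) → Set Ω := fun k =>
    N.X0 ⁻¹' A ∩ {ω | ∀ j i, N.count j (B j i) ω = (k j i : ℕ∞)}
  have hEm : ∀ k, MeasurableSet (E k) := fun k => by
    refine (N.measurable_X0 hA).inter ?_
    simp only [ofPred_forall]
    refine MeasurableSet.iInter fun j => MeasurableSet.iInter fun i => ?_
    exact N.measurable_count j (hB j i) (measurableSet_singleton _)
  have hEd : Pairwise (Function.onFun Disjoint E) := fun k k' hkk => by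
    refine Set.disjoint_left.2 fun ω h1 h2 => hkk ?_
    ext j i
    have := (h1.2 j i).symm.trans (h2.2 j i)
    exact_mod_cast this
  have hpm : ∀ j i n, Measurable fun x =>
      poissonMeasure (N.intensity j x (B j i)).toNNReal {n} := fun j i n =>
    (measurable_poissonMeasure_singleton n).comp
      ((N.intensity j).measurable_coe (hB j i)).ennreal_toNNReal
  have key : ∀ c : J → Fin m → ℝ≥0∞,
      ∑' k : J → Fin m → ℕ, (∏ j, ∏ i, expNeg (c j i) ^ k j i) * P (E k) =
        ∫⁻ x in A, expNeg (∑ j, ∑ i, (1 - expNeg (c j i)) * N.intensity j x (B j i))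
          ∂(P.map N.X0) := by
    intro c
    have h1 : ∀ k : J → Fin m → ℕ, (∏ j, ∏ i, expNeg (c j i) ^ k j i) * P (E k) =
        ∫⁻ x in A, ∏ j, ∏ i, (expNeg (c j i) ^ k j i *
          poissonMeasure (N.intensity j x (B j i)).toNNReal {k j i}) ∂(P.map N.X0) := by
      intro k
      simp only [Finset.prod_mul_distrib]
      rw [lintegral_const_mul _ (by fun_prop)]
      congr 1
      exact N.poisson A hA m B hB hBb hBd k
    simp only [h1]
    rw [← lintegral_tsum fun k => (Finset.measurable_prod _ fun j _ =>
      Finset.measurable_prod _ fun i _ => (hpm j i (k j i)).const_mul _).aemeasurable]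
    refine lintegral_congr fun x => ?_
    rw [tsum_pi_prod (fun j (l : Fin m → ℕ) => ∏ i, (expNeg (c j i) ^ l i *
          poissonMeasure (N.intensity j x (B j i)).toNNReal {l i})), expNeg_sum]
    refine Finset.prod_congr rfl fun j _ => ?_
    rw [tsum_pi_prod (fun i n => expNeg (c j i) ^ n *
          poissonMeasure (N.intensity j x (B j i)).toNNReal {n}), expNeg_sum]
    exact Finset.prod_congr rfl fun i _ =>
      tsum_pow_mul_poissonMeasure _ (N.intensity_ne_top j x (hBb j i))
  -- Taking c = 0 shows that the events `E k` carry the whole mass of X₀ ∈ A, so the counts are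
  -- almost surely finite there.
  have hfull : P (⋃ k, E k) = P (N.X0 ⁻¹' A) := by
    rw [measure_iUnion hEd hEm]
    have := key 0
    simp only [Pi.zero_apply, expNeg_zero, one_pow, Finset.prod_const_one, one_mul, tsub_self,
      zero_mul, Finset.sum_const_zero, lintegral_one, Measure.restrict_apply_univ] at this
    rw [this, Measure.map_apply N.measurable_X0 hA]
  have hae : (⋃ k, E k) =ᵐ[P] N.X0 ⁻¹' A :=
    ae_eq_of_subset_of_measure_ge (iUnion_subset fun k => inter_subset_left) hfull.ge
      (MeasurableSet.iUnion hEm).nullMeasurableSet (measure_ne_top _ _)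
  rw [← setLIntegral_congr hae, lintegral_iUnion hEm hEd, ← key c]
  refine tsum_congr fun k => ?_
  rw [← setLIntegral_const]
  refine setLIntegral_congr_fun (hEm k) fun ω hω => ?_
  simp only [expNeg_sum]
  refine Finset.prod_congr rfl fun j _ => Finset.prod_congr rfl fun i _ => ?_
  rw [hω.2 j i, ENat.toENNReal_coe, expNeg_mul_natCast]

/-- The Laplace functional of the superposed Poisson processes, given the location of the
associated transmitter. -/
theorem lintegral_expNeg_loc (N : PPPNetwork P J M θ) {A : Set Plane} (hA : MeasurableSet A)
    (ψ : J → Plane → ℝ≥0∞) (hψ : ∀ j, Measurable (ψ j)) :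
    ∫⁻ ω in N.X0 ⁻¹' A, expNeg (∑ j, ∑' n : ℕ,
        if (n : ℕ∞) < N.num j ω then ψ j (N.loc j n ω) else 0) ∂P =
      ∫⁻ x in A, expNeg (∑ j, ∫⁻ y, (1 - expNeg (ψ j y)) ∂(N.intensity j x)) ∂(P.map N.X0) := by
  classical
  -- Simple functions increasing to ψ are cut off to balls, because the Poisson hypothesis concerns
  -- bounded sets only.
  let F : ℕ → J → SimpleFunc Plane ℝ≥0∞ := fun l j => SimpleFunc.eapprox (ψ j) l
  let g : ℕ → J → Plane → ℝ≥0∞ := fun l j => (Metric.ball 0 (l : ℝ)).indicator (F l j)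
  have hgm : ∀ l j, Measurable (g l j) := fun l j =>
    (F l j).measurable.indicator measurableSet_ball
  have hgmono : ∀ j y, Monotone fun l => g l j y := by
    intro j y l l' hl
    simp only [g]
    refine (indicator_le_indicator (SimpleFunc.monotone_eapprox (ψ j) hl y)).trans ?_
    exact indicator_le_indicator_of_subset
      (Metric.ball_subset_ball (by exact_mod_cast hl)) (fun _ => zero_le) y
  have hglim : ∀ j y, Tendsto (fun l => g l j y) atTop (nhds (ψ j y)) := by
    intro j y
    have h1 : Tendsto (fun l => F l j y) atTop (nhds (ψ j y)) := by
      have := tendsto_atTop_iSup (f := fun l => F l j y)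
        (fun l l' hl => SimpleFunc.monotone_eapprox (ψ j) hl y)
      rwa [SimpleFunc.iSup_eapprox_apply (hψ j)] at this
    refine h1.congr' ?_
    filter_upwards [eventually_gt_atTop ⌈‖y‖⌉₊] with l hl
    simp only [g]
    rw [indicator_of_mem]
    rw [mem_ball_zero_iff]
    exact (Nat.le_ceil _).trans_lt (by exact_mod_cast hl)
  have step : ∀ l, ∫⁻ ω in N.X0 ⁻¹' A, expNeg (∑ j, ∑' n : ℕ,
        if (n : ℕ∞) < N.num j ω then g l j (N.loc j n ω) else 0) ∂P =
      ∫⁻ x in A, expNeg (∑ j, ∫⁻ y, (1 - expNeg (g l j y)) ∂(N.intensity j x))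
        ∂(P.map N.X0) := by
    intro l
    -- One list of values serves all types, since the number of sets must not depend on j.
    let R : Finset ℝ≥0∞ := Finset.univ.biUnion fun j => (F l j).range
    let c : Fin R.card → ℝ≥0∞ := fun i => (R.equivFin.symm i : ℝ≥0∞)
    have hc : Function.Injective c := Subtype.val_injective.comp R.equivFin.symm.injective
    let B : J → Fin R.card → Set Plane := fun j i => Metric.ball 0 (l : ℝ) ∩ F l j ⁻¹' {c i}
    have hB : ∀ j i, MeasurableSet (B j i) := fun j i =>
      measurableSet_ball.inter ((F l j).measurableSet_preimage _)
    have hBd : ∀ j, Pairwise fun i i' => Disjoint (B j i) (B j i') := by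
      intro j i i' hii
      refine Set.disjoint_left.2 fun y h1 h2 => hii (hc ?_)
      exact h1.2.symm.trans h2.2
    -- Used with h(t) = t on the left side and h(t) = 1 - e^{-t} on the right; h(0) = 0 removes the
    -- points outside the ball.
    have hdec : ∀ (h : ℝ≥0∞ → ℝ≥0∞), h 0 = 0 → ∀ j y,
        h (g l j y) = ∑ i, h (c i) * (B j i).indicator 1 y := by
      intro h h0 j y
      by_cases hy : y ∈ Metric.ball (0 : Plane) (l : ℝ)
      · have hmem : F l j y ∈ R :=
          Finset.mem_biUnion.2 ⟨j, Finset.mem_univ _, SimpleFunc.mem_range_self _ _⟩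
        have hci : c (R.equivFin ⟨F l j y, hmem⟩) = F l j y := by simp [c]
        rw [Finset.sum_eq_single (R.equivFin ⟨F l j y, hmem⟩)]
        · rw [hci, indicator_of_mem (show y ∈ B j _ from ⟨hy, hci.symm⟩)]
          simp [g, hy]
        · intro i _ hi
          rw [indicator_of_notMem, mul_zero]
          exact fun hyB => hi (hc (hyB.2.symm.trans hci.symm))
        · simp
      · rw [Finset.sum_eq_zero]
        · simp [g, hy, h0]
        · intro i _
          rw [indicator_of_notMem (fun hyB => hy hyB.1), mul_zero]
    have h := N.lintegral_expNeg_count hA B hB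
      (fun j i => Metric.isBounded_ball.subset inter_subset_left) hBd (fun _ i => c i)
    convert h using 4 with ω x
    · refine Finset.sum_congr rfl fun j _ => ?_
      simp only [N.count_eq_tsum, ← ENNReal.tsum_mul_left]
      rw [← Summable.tsum_finsetSum fun i _ => ENNReal.summable]
      refine tsum_congr fun n => ?_
      split_ifs
      · exact hdec id rfl j _
      · simp
    · refine Finset.sum_congr rfl fun j _ => ?_
      simp only [hdec (fun t => 1 - expNeg t) (by simp) j]
      rw [lintegral_finsetSum _ fun i _ => (measurable_one.indicator (hB j i)).const_mul _]
      refine Finset.sum_congr rfl fun i _ => ?_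
      rw [lintegral_const_mul _ (measurable_one.indicator (hB j i)),
        lintegral_indicator_one (hB j i)]
  have hL : Tendsto (fun l => ∫⁻ ω in N.X0 ⁻¹' A, expNeg (∑ j, ∑' n : ℕ,
        if (n : ℕ∞) < N.num j ω then g l j (N.loc j n ω) else 0) ∂P) atTop
      (nhds (∫⁻ ω in N.X0 ⁻¹' A, expNeg (∑ j, ∑' n : ℕ,
        if (n : ℕ∞) < N.num j ω then ψ j (N.loc j n ω) else 0) ∂P)) := by
    refine tendsto_lintegral_of_dominated_convergence (fun _ => 1) ?_ ?_ (by simp) ?_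
    · intro l
      refine measurable_expNeg.comp (Finset.measurable_sum _ fun j _ =>
        Measurable.tsum fun n => ?_)
      exact Measurable.ite (N.measurableSet_lt_num j n)
        ((hgm l j).comp (N.measurable_loc j n)) measurable_const
    · exact fun l => ae_of_all _ fun ω => expNeg_le_one _
    · refine ae_of_all _ fun ω => (continuous_expNeg.tendsto _).comp ?_
      refine tendsto_finsetSum _ fun j _ => ?_
      -- Monotone convergence for counting measure; an infinite limit is harmless as `expNeg` is
      -- continuous at ∞.
      simp only [← lintegral_count]
      refine lintegral_tendsto_of_tendsto_of_monotone
        (fun l => (Measurable.of_discrete).aemeasurable) (ae_of_all _ fun n => ?_)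
        (ae_of_all _ fun n => ?_)
      · intro l l' hl
        dsimp only
        split_ifs
        · exact hgmono _ _ hl
        · exact le_rfl
      · split_ifs
        · exact hglim _ _
        · exact tendsto_const_nhds
  have hR : Tendsto (fun l => ∫⁻ x in A,
        expNeg (∑ j, ∫⁻ y, (1 - expNeg (g l j y)) ∂(N.intensity j x)) ∂(P.map N.X0)) atTop
      (nhds (∫⁻ x in A,
        expNeg (∑ j, ∫⁻ y, (1 - expNeg (ψ j y)) ∂(N.intensity j x)) ∂(P.map N.X0))) := by
    have hm : ∀ l j, Measurable fun y => 1 - expNeg (g l j y) := fun l j =>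
      (measurable_expNeg.comp (hgm l j)).const_sub _
    have : IsProbabilityMeasure (P.map N.X0) :=
      Measure.isProbabilityMeasure_map N.measurable_X0.aemeasurable
    refine tendsto_lintegral_of_dominated_convergence (fun _ => 1) ?_ ?_ (by simp) ?_
    · intro l
      exact measurable_expNeg.comp (Finset.measurable_sum _ fun j _ =>
        (hm l j).lintegral_kernel)
    · exact fun l => ae_of_all _ fun ω => expNeg_le_one _
    · refine ae_of_all _ fun x => (continuous_expNeg.tendsto _).comp ?_
      refine tendsto_finsetSum _ fun j _ => ?_
      refine lintegral_tendsto_of_tendsto_of_monotone (fun l => (hm l j).aemeasurable)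
        (ae_of_all _ fun y => ?_) (ae_of_all _ fun y => ?_)
      · exact fun l l' hl => tsub_le_tsub_left (expNeg_antitone (hgmono j y hl)) _
      · exact ENNReal.Tendsto.sub tendsto_const_nhds
          ((continuous_expNeg.tendsto _).comp (hglim j y)) (Or.inl ENNReal.one_ne_top)
  simp only [step] at hL
  exact tendsto_nhds_unique hL hR

end PPPNetwork

/-! ### Averaging conditionally independent marks -/

/-- If the variables `G p` are conditionally independent given `Z`, with the conditional
distributions `κ p`, then conditional expectations of products of functions of `Z` and a single
`G p` factor. -/
theorem setLIntegral_prod_eq_of_condIndep {Ω 𝒵 𝒢 ι : Type*} [Countable ι]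
    [MeasurableSpace Ω] [MeasurableSpace 𝒵] [MeasurableSpace 𝒢] {P : Measure Ω} [IsFiniteMeasure P]
    {Z : Ω → 𝒵} (hZ : Measurable Z) {G : ι → Ω → 𝒢} (hG : ∀ p, Measurable (G p))
    (κ : ι → Kernel 𝒵 𝒢) [∀ p, IsMarkovKernel (κ p)]
    (hκ : ∀ H, MeasurableSet H → ∀ (S : Finset ι) (C : ι → Set 𝒢), (∀ p, MeasurableSet (C p)) →
      P {ω | Z ω ∈ H ∧ ∀ p ∈ S, G p ω ∈ C p} = ∫⁻ ω in Z ⁻¹' H, ∏ p ∈ S, κ p (Z ω) (C p) ∂P)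
    (h : ι → 𝒵 → 𝒢 → ℝ≥0∞) (hm : ∀ p, Measurable (Function.uncurry (h p)))
    (h1 : ∀ p z g, h p z g ≤ 1) (S : Finset ι) {H : Set 𝒵} (hH : MeasurableSet H) :
    ∫⁻ ω in Z ⁻¹' H, ∏ p ∈ S, h p (Z ω) (G p ω) ∂P =
      ∫⁻ ω in Z ⁻¹' H, ∏ p ∈ S, ∫⁻ g, h p (Z ω) g ∂(κ p (Z ω)) ∂P := by
  classical
  -- Induction on the set T of indices whose factors are arbitrary, all others being indicators. For
  -- T = ∅ this is `hκ`.
  suffices key : ∀ (T S : Finset ι) (h : ι → 𝒵 → 𝒢 → ℝ≥0∞),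
      (∀ p, Measurable (Function.uncurry (h p))) → (∀ p z g, h p z g ≤ 1) →
      (∀ p ∈ S, p ∉ T → ∃ C, MeasurableSet C ∧ h p = fun _ => C.indicator 1) →
      ∀ H, MeasurableSet H → ∫⁻ ω in Z ⁻¹' H, ∏ p ∈ S, h p (Z ω) (G p ω) ∂P =
        ∫⁻ ω in Z ⁻¹' H, ∏ p ∈ S, ∫⁻ g, h p (Z ω) g ∂(κ p (Z ω)) ∂P from
    key S S h hm h1 (fun p hp hp' => absurd hp hp') H hH
  clear hH H S h1 hm h
  intro T
  induction T using Finset.induction_on with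
  | empty =>
    intro S h hm h1 hC H hH
    choose! C hCm hC using fun p hp => hC p hp (Finset.notMem_empty p)
    let C' : ι → Set 𝒢 := fun p => if p ∈ S then C p else ∅
    have hC'm : ∀ p, MeasurableSet (C' p) := fun p => by
      by_cases hp : p ∈ S
      · simpa [C', hp] using hCm p hp
      · simp [C', hp]
    have hC' : ∀ p ∈ S, h p = fun _ => (C' p).indicator 1 := fun p hp => by
      simpa [C', hp] using hC p hp
    have e1 : ∀ ω, ∏ p ∈ S, h p (Z ω) (G p ω) =
        {ω | ∀ p ∈ S, G p ω ∈ C' p}.indicator 1 ω := by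
      intro ω
      by_cases hω : ∀ p ∈ S, G p ω ∈ C' p
      · rw [indicator_of_mem (show ω ∈ {ω | ∀ p ∈ S, G p ω ∈ C' p} from hω)]
        refine Finset.prod_eq_one fun p hp => ?_
        rw [hC' p hp]
        exact indicator_of_mem (hω p hp) 1
      · rw [indicator_of_notMem (show ω ∉ {ω | ∀ p ∈ S, G p ω ∈ C' p} from hω)]
        push Not at hω
        obtain ⟨p, hp, hpω⟩ := hω
        refine Finset.prod_eq_zero hp ?_
        rw [hC' p hp]
        exact indicator_of_notMem hpω 1
    have e2 : ∀ ω, ∏ p ∈ S, ∫⁻ g, h p (Z ω) g ∂(κ p (Z ω)) =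
        ∏ p ∈ S, κ p (Z ω) (C' p) := by
      intro ω
      refine Finset.prod_congr rfl fun p hp => ?_
      rw [hC' p hp, lintegral_indicator_one (hC'm p)]
    have hm' : MeasurableSet {ω | ∀ p ∈ S, G p ω ∈ C' p} := by
      simp only [ofPred_forall]
      exact MeasurableSet.iInter fun p => MeasurableSet.iInter fun _ => hG p (hC'm p)
    simp only [e1, e2]
    rw [← hκ H hH S C' hC'm, lintegral_indicator_one hm', Measure.restrict_apply hm', inter_comm]
    rfl
  | insert q T hq ih =>
    intro S h hm h1 hC H hH
    by_cases hqS : q ∈ S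
    swap
    · refine ih S h hm h1 (fun p hp hpT => hC p hp fun hpi => ?_) H hH
      rcases Finset.mem_insert.1 hpi with rfl | hpi
      · exact hqS hp
      · exact hpT hpi
    set S' := S.erase q
    have hS : S = insert q S' := (Finset.insert_erase hqS).symm
    have hqS' : q ∉ S' := Finset.notMem_erase q S
    let k : ι → 𝒵 → ℝ≥0∞ := fun p z => ∫⁻ g, h p z g ∂(κ p z)
    have hk : ∀ p, Measurable (k p) := fun p => (hm p).lintegral_kernel_prod_right'
    have hk1 : ∀ p z, k p z ≤ 1 := fun p z =>
      (lintegral_mono fun g => h1 p z g).trans (by simp)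
    let w : Ω → ℝ≥0∞ := fun ω => ∏ p ∈ S', h p (Z ω) (G p ω)
    let v : Ω → ℝ≥0∞ := fun ω => ∏ p ∈ S', k p (Z ω)
    have hw : Measurable w := Finset.measurable_prod _ fun p _ =>
      (hm p).comp (hZ.prodMk (hG p))
    have hv : Measurable v := Finset.measurable_prod _ fun p _ => (hk p).comp hZ
    have hfin : ∀ u : Ω → ℝ≥0∞, (∀ ω, u ω ≤ 1) → IsFiniteMeasure (P.withDensity u) := by
      intro u hu
      refine isFiniteMeasure_withDensity (ne_top_of_le_ne_top (measure_ne_top P univ) ?_)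
      exact (lintegral_mono hu).trans (by simp)
    have := hfin w fun ω => Finset.prod_le_one' fun p _ => h1 _ _ _
    have := hfin v fun ω => Finset.prod_le_one' fun p _ => hk1 _ _
    have hZG : Measurable fun ω => (Z ω, G q ω) := hZ.prodMk (hG q)
    -- The remaining factors serve as densities, unaveraged in `w` and averaged in `v`. The
    -- induction hypothesis, with the factor at q replaced by an indicator, equates two finite
    -- measures on rectangles, hence everywhere. Integrating `h q` against both gives the claim.
    have hmeas : (P.withDensity w).map (fun ω => (Z ω, G q ω)) =
        ((P.withDensity v).map Z) ⊗ₘ κ q := by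
      refine Measure.ext_prod fun {A D} hA hD => ?_
      rw [Measure.map_apply hZG (hA.prod hD), Measure.compProd_apply_prod hA hD,
        setLIntegral_map hA ((κ q).measurable_coe hD) hZ,
        setLIntegral_withDensity_eq_setLIntegral_mul _ hv
          (show Measurable fun ω => κ q (Z ω) D from ((κ q).measurable_coe hD).comp hZ) (hZ hA),
        withDensity_apply _ (hZG (hA.prod hD))]
      let h' : ι → 𝒵 → 𝒢 → ℝ≥0∞ := Function.update h q fun _ => D.indicator 1
      have hq' : h' q = fun _ => D.indicator 1 := Function.update_self ..
      have hne : ∀ p ∈ S', h' p = h p := fun p hp =>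
        Function.update_of_ne (ne_of_mem_of_not_mem hp hqS') ..
      have hind : Measurable (Function.uncurry fun (_ : 𝒵) => D.indicator (1 : 𝒢 → ℝ≥0∞)) :=
        (measurable_one.indicator hD).comp measurable_snd
      have := ih S h' (fun p => ?_) (fun p z g => ?_) (fun p hp hpT => ?_) A hA
      · rw [hS] at this
        simp only [Finset.prod_insert hqS'] at this
        have ew : ∀ ω, ∏ p ∈ S', h' p (Z ω) (G p ω) = w ω := fun ω =>
          Finset.prod_congr rfl fun p hp => by rw [hne p hp]
        have ev : ∀ ω, ∏ p ∈ S', ∫⁻ g, h' p (Z ω) g ∂(κ p (Z ω)) = v ω := fun ω =>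
          Finset.prod_congr rfl fun p hp => by rw [hne p hp]
        simp only [ew, ev, hq', lintegral_indicator_one hD] at this
        have e3 : ∀ ω, D.indicator 1 (G q ω) * w ω = (G q ⁻¹' D).indicator w ω := fun ω => by
          by_cases hω : G q ω ∈ D
          · rw [indicator_of_mem hω, indicator_of_mem (show ω ∈ G q ⁻¹' D from hω)]
            simp
          · rw [indicator_of_notMem hω, indicator_of_notMem (show ω ∉ G q ⁻¹' D from hω), zero_mul]
        simp only [e3] at this
        rw [lintegral_indicator (hG q hD), Measure.restrict_restrict (hG q hD), inter_comm] at this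
        rw [show (fun ω => (Z ω, G q ω)) ⁻¹' A ×ˢ D = Z ⁻¹' A ∩ G q ⁻¹' D from rfl, this]
        refine lintegral_congr fun ω => ?_
        simp only [Pi.mul_apply]
        exact mul_comm _ _
      · by_cases hp : p = q
        · subst hp
          rw [hq']
          exact hind
        · rw [show h' p = h p from Function.update_of_ne hp ..]
          exact hm p
      · by_cases hp : p = q
        · subst hp
          rw [hq']
          exact indicator_le_self' (fun _ _ => zero_le) g
        · rw [show h' p = h p from Function.update_of_ne hp ..]
          exact h1 p z g
      · by_cases hpq : p = q
        · subst hpq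
          exact ⟨D, hD, hq'⟩
        · rw [show h' p = h p from Function.update_of_ne hpq ..]
          exact hC p hp fun hpi => (Finset.mem_insert.1 hpi).elim hpq hpT
    have hfinal : ∫⁻ x in H ×ˢ univ, Function.uncurry (h q) x
          ∂((P.withDensity w).map (fun ω => (Z ω, G q ω))) =
        ∫⁻ x in H ×ˢ univ, Function.uncurry (h q) x ∂(((P.withDensity v).map Z) ⊗ₘ κ q) := by
      rw [hmeas]
    rw [setLIntegral_map (hH.prod MeasurableSet.univ) (hm q) hZG,
      Measure.setLIntegral_compProd (hm q) hH MeasurableSet.univ,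
      setLIntegral_withDensity_eq_setLIntegral_mul _ hw
        (show Measurable fun ω => Function.uncurry (h q) (Z ω, G q ω) from (hm q).comp hZG)
        (hZG (hH.prod MeasurableSet.univ))] at hfinal
    simp only [Measure.restrict_univ] at hfinal
    change _ = ∫⁻ a in H, k q a ∂_ at hfinal
    rw [setLIntegral_map hH (hk q) hZ,
      setLIntegral_withDensity_eq_setLIntegral_mul _ hv
        (show Measurable fun ω => k q (Z ω) from (hk q).comp hZ) (hZ hH)] at hfinal
    rw [show (fun ω => (Z ω, G q ω)) ⁻¹' H ×ˢ univ = Z ⁻¹' H by ext; simp] at hfinal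
    rw [hS]
    simp only [Finset.prod_insert hqS']
    calc _ = ∫⁻ ω in Z ⁻¹' H, (w * fun ω => Function.uncurry (h q) (Z ω, G q ω)) ω ∂P :=
          lintegral_congr fun ω => mul_comm _ _
      _ = _ := hfinal
      _ = _ := lintegral_congr fun ω => mul_comm _ _

/-! ### Conditional Laplace transform of the interference -/

namespace PPPNetwork

variable {Ω : Type*} [MeasurableSpace Ω] {P : Measure Ω} {J : Type*} [Fintype J] {M : ℕ} {θ : ℝ}

/-- The Laplace transform at `s` of the power received from an interferer of type `j` at `y`. -/
noncomputable def powerLaplace (N : PPPNetwork P J M θ) (α : ℝ) (s : ℝ≥0∞) (j : J) (y : Plane) :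
    ℝ≥0∞ :=
  ∫⁻ g : ℝ≥0, expNeg (s * (g * ‖y‖ₑ ^ (-α))) ∂(N.gainLaw j y)

theorem measurable_expNeg_power (α : ℝ) (s : ℝ≥0∞) :
    Measurable fun x : Plane × ℝ≥0 => expNeg (s * (x.2 * ‖x.1‖ₑ ^ (-α))) := by
  have := measurable_expNeg
  fun_prop

theorem measurable_powerLaplace (N : PPPNetwork P J M θ) (α : ℝ) (s : ℝ≥0∞) (j : J) :
    Measurable (N.powerLaplace α s j) := by
  have := N.isMarkovKernel_gainLaw j
  exact (measurable_expNeg_power α s).lintegral_kernel_prod_right'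

theorem powerLaplace_le_one (N : PPPNetwork P J M θ) (α : ℝ) (s : ℝ≥0∞) (j : J) (y : Plane) :
    N.powerLaplace α s j y ≤ 1 := by
  have := N.isMarkovKernel_gainLaw j
  exact (lintegral_mono fun g => expNeg_le_one _).trans (by simp)

theorem measurable_interference (N : PPPNetwork P J M θ) (α : ℝ) :
    Measurable (N.interference α) := by
  refine Finset.measurable_sum _ fun j _ => Measurable.tsum fun n => ?_
  refine Measurable.ite (N.measurableSet_lt_num j n) ?_ measurable_const
  have := N.measurable_gain j n
  have := N.measurable_loc j n
  fun_prop

variable [IsProbabilityMeasure P]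

/-- The conditional Laplace transform of the interference, given the location of the associated
transmitter. -/
theorem lintegral_expNeg_interference (N : PPPNetwork P J M θ) (α : ℝ) (s : ℝ≥0∞)
    {A : Set Plane} (hA : MeasurableSet A) :
    ∫⁻ ω in N.X0 ⁻¹' A, expNeg (s * N.interference α ω) ∂P =
      ∫⁻ x in A, expNeg (∑ j, ∫⁻ y, (1 - N.powerLaplace α s j y) ∂(N.intensity j x))
        ∂(P.map N.X0) := by
  classical
  let Z : Ω → Plane × (J → ℕ∞) × (J → ℕ → Plane) := fun ω =>
    (N.X0 ω, (fun j => N.num j ω), (fun j n => N.loc j n ω))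
  have hZ : Measurable Z := N.measurable_X0.prodMk
    ((measurable_pi_lambda _ N.measurable_num).prodMk
      (measurable_pi_lambda _ fun j => measurable_pi_lambda _ (N.measurable_loc j)))
  have hloc : ∀ p : J × ℕ, Measurable
      fun z : Plane × (J → ℕ∞) × (J → ℕ → Plane) => z.2.2 p.1 p.2 := fun p =>
    (measurable_pi_apply p.2).comp ((measurable_pi_apply p.1).comp
      (measurable_snd.comp measurable_snd))
  have hnum : ∀ p : J × ℕ, MeasurableSet
      {z : Plane × (J → ℕ∞) × (J → ℕ → Plane) | (p.2 : ℕ∞) < z.2.1 p.1} := fun p =>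
    (show Measurable fun z : Plane × (J → ℕ∞) × (J → ℕ → Plane) => z.2.1 p.1 from
      (measurable_pi_apply p.1).comp (measurable_fst.comp measurable_snd))
      (Set.to_countable (Ioi (p.2 : ℕ∞))).measurableSet
  let κ : J × ℕ → Kernel (Plane × (J → ℕ∞) × (J → ℕ → Plane)) ℝ≥0 := fun p =>
    (N.gainLaw p.1).comap _ (hloc p)
  have : ∀ p, IsMarkovKernel (κ p) := fun p => by
    have := N.isMarkovKernel_gainLaw p.1
    exact Kernel.IsMarkovKernel.comap _ (hloc p)
  -- Indices n ≥ `num j` receive the factor 1, so products may run over a deterministic range.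
  let h : J × ℕ → (Plane × (J → ℕ∞) × (J → ℕ → Plane)) → ℝ≥0 → ℝ≥0∞ := fun p z g =>
    if (p.2 : ℕ∞) < z.2.1 p.1 then expNeg (s * (g * ‖z.2.2 p.1 p.2‖ₑ ^ (-α))) else 1
  have hm : ∀ p, Measurable (Function.uncurry (h p)) := fun p =>
    Measurable.ite (measurable_fst (hnum p))
      ((measurable_expNeg_power α s).comp
        (((hloc p).comp measurable_fst).prodMk measurable_snd)) measurable_const
  have h1 : ∀ p z g, h p z g ≤ 1 := fun p z g => by
    simp only [h]
    split_ifs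
    · exact expNeg_le_one _
    · exact le_rfl
  have hstep : ∀ l : ℕ, ∫⁻ ω in N.X0 ⁻¹' A, expNeg (∑ j, ∑ n ∈ Finset.range l,
        if (n : ℕ∞) < N.num j ω then s * (N.gain j n ω * ‖N.loc j n ω‖ₑ ^ (-α)) else 0) ∂P =
      ∫⁻ ω in N.X0 ⁻¹' A, expNeg (∑ j, ∑ n ∈ Finset.range l,
        if (n : ℕ∞) < N.num j ω then negLog (N.powerLaplace α s j (N.loc j n ω)) else 0) ∂P := by
    intro l
    have := setLIntegral_prod_eq_of_condIndep hZ (fun p : J × ℕ => N.measurable_gain p.1 p.2) κ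
      (fun H hH S C hC => N.gain_law H hH S C hC) h hm h1 (Finset.univ ×ˢ Finset.range l)
      (measurable_fst hA)
    simp only [Finset.prod_product] at this
    simp only [expNeg_sum]
    refine Eq.trans ?_ (this.trans ?_)
    · refine lintegral_congr fun ω => Finset.prod_congr rfl fun j _ =>
        Finset.prod_congr rfl fun n _ => ?_
      simp only [h, Z]
      split_ifs
      · rfl
      · simp
    · refine lintegral_congr fun ω => Finset.prod_congr rfl fun j _ =>
        Finset.prod_congr rfl fun n _ => ?_
      simp only [h, Z, κ, Kernel.comap_apply]
      split_ifs
      · exact (expNeg_negLog (N.powerLaplace_le_one α s j _)).symm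
      · have := N.isMarkovKernel_gainLaw j
        simp
  have hlim : ∀ a : J → ℕ → Ω → ℝ≥0∞, (∀ j n, Measurable (a j n)) →
      Tendsto (fun l : ℕ => ∫⁻ ω in N.X0 ⁻¹' A, expNeg (∑ j, ∑ n ∈ Finset.range l,
        if (n : ℕ∞) < N.num j ω then a j n ω else 0) ∂P) atTop
      (nhds (∫⁻ ω in N.X0 ⁻¹' A, expNeg (∑ j, ∑' n : ℕ,
        if (n : ℕ∞) < N.num j ω then a j n ω else 0) ∂P)) := by
    intro a ha
    refine tendsto_lintegral_of_dominated_convergence (fun _ => 1) ?_ ?_ (by simp) ?_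
    · exact fun l => measurable_expNeg.comp (Finset.measurable_sum _ fun j _ =>
        Finset.measurable_sum _ fun n _ =>
          Measurable.ite (N.measurableSet_lt_num j n) (ha j n) measurable_const)
    · exact fun l => ae_of_all _ fun ω => expNeg_le_one _
    · exact ae_of_all _ fun ω => (continuous_expNeg.tendsto _).comp
        (tendsto_finsetSum _ fun j _ => ENNReal.tendsto_nat_tsum _)
  have l1 := hlim (fun j n ω => s * (N.gain j n ω * ‖N.loc j n ω‖ₑ ^ (-α))) (fun j n => by
    have := N.measurable_gain j n
    have := N.measurable_loc j n
    fun_prop)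
  have l2 := hlim (fun j n ω => negLog (N.powerLaplace α s j (N.loc j n ω))) (fun j n =>
    measurable_negLog.comp ((N.measurable_powerLaplace α s j).comp (N.measurable_loc j n)))
  simp only [hstep] at l1
  have h3 := tendsto_nhds_unique l1 l2
  -- With the gains averaged out, the exponent is a sum of a deterministic function over the points
  -- of the processes.
  rw [N.lintegral_expNeg_loc hA (fun j y => negLog (N.powerLaplace α s j y))
    (fun j => measurable_negLog.comp (N.measurable_powerLaplace α s j))] at h3
  simp only [expNeg_negLog (N.powerLaplace_le_one α s _ _)] at h3
  rw [← h3]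
  refine lintegral_congr fun ω => ?_
  rw [interference, Finset.mul_sum]
  simp only [← ENNReal.tsum_mul_left, mul_ite, mul_zero]

end PPPNetwork

/-! ### The exponent: behaviour at the origin, monotonicity, finiteness -/

namespace PPPNetwork

variable {Ω : Type*} [MeasurableSpace Ω] {P : Measure Ω} {J : Type*} [Fintype J] {M : ℕ} {θ : ℝ}

theorem integrable_exp_power (N : PPPNetwork P J M θ) (α : ℝ) (j : J) (y : Plane) {s : ℝ}
    (hs : 0 ≤ s) :
    Integrable (fun g : ℝ≥0 => Real.exp (-s * (g : ℝ) * ‖y‖ ^ (-α))) (N.gainLaw j y) := by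
  have := N.isMarkovKernel_gainLaw j
  refine Integrable.mono' (integrable_const (1 : ℝ)) (by fun_prop) (ae_of_all _ fun g => ?_)
  rw [Real.norm_of_nonneg (Real.exp_nonneg _), Real.exp_le_one_iff, neg_mul, neg_mul]
  have := Real.rpow_nonneg (norm_nonneg y) (-α)
  have := g.coe_nonneg
  exact neg_nonpos.2 (by positivity)

/-- The origin is excluded because the conventions differ there: 0^{-α} is ∞ in [0, ∞] but 0 in ℝ.
-/
theorem one_sub_powerLaplace (N : PPPNetwork P J M θ) (α : ℝ) (j : J) {y : Plane} (hy : y ≠ 0)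
    {s : ℝ} (hs : 0 ≤ s) :
    1 - N.powerLaplace α (ENNReal.ofReal s) j y = ENNReal.ofReal
      (1 - ∫ g : ℝ≥0, Real.exp (-s * (g : ℝ) * ‖y‖ ^ (-α)) ∂(N.gainLaw j y)) := by
  have hy' : 0 < ‖y‖ := norm_pos_iff.2 hy
  rw [ENNReal.ofReal_sub _ (integral_nonneg fun _ => Real.exp_nonneg _), ENNReal.ofReal_one,
    ofReal_integral_eq_lintegral_ofReal (N.integrable_exp_power α j y hs)
      (ae_of_all _ fun _ => Real.exp_nonneg _), powerLaplace]
  congr 1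
  refine lintegral_congr fun g => ?_
  rw [← ofReal_norm, ENNReal.ofReal_rpow_of_pos hy', ← ENNReal.ofReal_coe_nnreal,
    ← ENNReal.ofReal_mul g.coe_nonneg, ← ENNReal.ofReal_mul hs, expNeg_ofReal]
  · congr 2
    ring
  · have := g.coe_nonneg
    positivity

/-- Power received from the origin is 0 or ∞, so its Laplace transform is the probability of a zero
gain, whatever s ≠ 0 is. -/
theorem powerLaplace_zero (N : PPPNetwork P J M θ) {α : ℝ} (hα : 0 < α) (j : J) {s : ℝ≥0∞}
    (hs : s ≠ 0) : N.powerLaplace α s j 0 = N.powerLaplace α 1 j 0 := by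
  refine lintegral_congr fun g => ?_
  rw [enorm_zero, ENNReal.zero_rpow_of_neg (neg_neg_of_pos hα), one_mul]
  by_cases hg : g = 0
  · simp [hg]
  · rw [ENNReal.mul_top (by exact_mod_cast hg), ENNReal.mul_top hs]

theorem measurable_gainTransform (N : PPPNetwork P J M θ) (α s : ℝ) (j : J) :
    Measurable fun y => ENNReal.ofReal
      (1 - ∫ g : ℝ≥0, Real.exp (-s * (g : ℝ) * ‖y‖ ^ (-α)) ∂(N.gainLaw j y)) := by
  have := N.isMarkovKernel_gainLaw j
  have h : StronglyMeasurable fun p : Plane × ℝ≥0 =>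
      Real.exp (-s * (p.2 : ℝ) * ‖p.1‖ ^ (-α)) :=
    Measurable.stronglyMeasurable (by fun_prop)
  exact ((h.integral_kernel_prod_right' (κ := N.gainLaw j)).measurable.const_sub 1).ennreal_ofReal

theorem measurable_interferenceExponent (N : PPPNetwork P J M θ) (α s : ℝ) :
    Measurable fun x => N.interferenceExponent α x s :=
  Finset.measurable_sum _ fun j _ => (N.measurable_gainTransform α s j).lintegral_kernel

theorem interferenceExponent_mono (N : PPPNetwork P J M θ) (α : ℝ) (x : Plane) {s t : ℝ}
    (hs : 0 ≤ s) (hst : s ≤ t) :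
    N.interferenceExponent α x s ≤ N.interferenceExponent α x t := by
  refine Finset.sum_le_sum fun j _ => lintegral_mono fun y => ENNReal.ofReal_le_ofReal ?_
  refine sub_le_sub_left (integral_mono (N.integrable_exp_power α j y (hs.trans hst))
    (N.integrable_exp_power α j y hs) fun g => Real.exp_le_exp.2 ?_) _
  have h1 := Real.rpow_nonneg (norm_nonneg y) (-α)
  have h2 := g.coe_nonneg
  nlinarith [mul_le_mul_of_nonneg_right hst (mul_nonneg h2 h1)]

theorem measurable_single : Measurable fun r : ℝ => (EuclideanSpace.single 0 r : Plane) :=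
  (Isometry.of_dist_eq (PiLp.dist_single_same 2 (fun _ : Fin 2 => ℝ) 0)).continuous.measurable

theorem measurable_eta (N : PPPNetwork P J M θ) (α noise s : ℝ) :
    Measurable fun r => N.eta α noise r s :=
  (((N.measurable_interferenceExponent α s).comp measurable_single).ennreal_toReal).const_sub _

theorem eta_nonpos (N : PPPNetwork P J M θ) (α : ℝ) {noise : ℝ} (hnoise : 0 ≤ noise) (r : ℝ)
    {s : ℝ} (hs : 0 < s) : N.eta α noise r s ≤ 0 := by
  have := (N.interferenceExponent α (EuclideanSpace.single 0 r) s).toReal_nonneg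
  have := mul_nonneg hs.le hnoise
  rw [eta]
  linarith

/-- Finiteness matters: `toReal` sends ∞ to 0 and would destroy monotonicity. -/
theorem eta_antitone (N : PPPNetwork P J M θ) {α noise r : ℝ} (hnoise : 0 ≤ noise)
    (hfin : ∀ s, 0 < s → N.interferenceExponent α (EuclideanSpace.single 0 r) s < ∞)
    {s t : ℝ} (hs : 0 < s) (hst : s ≤ t) : N.eta α noise r t ≤ N.eta α noise r s := by
  have h := ENNReal.toReal_mono (hfin t (hs.trans_le hst)).ne
    (N.interferenceExponent_mono α (EuclideanSpace.single 0 r) hs.le hst)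
  have := mul_le_mul_of_nonneg_right hst hnoise
  rw [eta, eta]
  linarith

theorem interferenceExponent_single (N : PPPNetwork P J M θ) {α : ℝ}
    (hrad : ∀ x x' : Plane, ‖x‖ = ‖x'‖ → ∀ s : ℝ, 0 < s →
      N.interferenceExponent α x s = N.interferenceExponent α x' s) (x : Plane) {s : ℝ}
    (hs : 0 < s) :
    N.interferenceExponent α (EuclideanSpace.single 0 ‖x‖) s = N.interferenceExponent α x s :=
  hrad _ _ (by simp) s hs

variable [IsProbabilityMeasure P]

/-- Almost surely there is no interferer with a positive gain at the origin. -/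
theorem ae_intensity_zero_mul (N : PPPNetwork P J M θ) {α : ℝ} (hα : 0 < α)
    (hI : ∀ᵐ ω ∂P, N.interference α ω < ∞) :
    ∀ᵐ x ∂(P.map N.X0), ∀ j, (1 - N.powerLaplace α 1 j 0) * N.intensity j x {0} = 0 := by
  have : IsProbabilityMeasure (P.map N.X0) :=
    Measure.isProbabilityMeasure_map N.measurable_X0.aemeasurable
  -- The contribution of the origin to the exponent does not depend on s. As s = 1/(n+1) → 0,
  -- finiteness of I gives E[e^{-sI}] → 1, so the mean of e^{-c} is at least 1 and c vanishes almost
  -- everywhere.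
  let c : Plane → ℝ≥0∞ := fun x => ∑ j, (1 - N.powerLaplace α 1 j 0) * N.intensity j x {0}
  have hpos : ∀ n : ℕ, ((n : ℝ≥0∞) + 1)⁻¹ ≠ 0 := fun n => by simp
  have hle : ∀ n : ℕ, ∫⁻ ω, expNeg (((n : ℝ≥0∞) + 1)⁻¹ * N.interference α ω) ∂P ≤
      ∫⁻ x, expNeg (c x) ∂(P.map N.X0) := by
    intro n
    have h := N.lintegral_expNeg_interference α ((n : ℝ≥0∞) + 1)⁻¹ MeasurableSet.univ
    rw [preimage_univ, Measure.restrict_univ, Measure.restrict_univ] at h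
    rw [h]
    refine lintegral_mono fun x => expNeg_antitone (Finset.sum_le_sum fun j _ => ?_)
    rw [← N.powerLaplace_zero hα j (hpos n)]
    rw [← lintegral_singleton (fun y => 1 - N.powerLaplace α ((n : ℝ≥0∞) + 1)⁻¹ j y) 0]
    exact setLIntegral_le_lintegral _ _
  have hlim : Tendsto (fun n : ℕ => ∫⁻ ω, expNeg (((n : ℝ≥0∞) + 1)⁻¹ * N.interference α ω) ∂P)
      atTop (nhds (∫⁻ _, 1 ∂P)) := by
    refine tendsto_lintegral_of_dominated_convergence (fun _ => 1) ?_ ?_ (by simp) ?_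
    · exact fun n => measurable_expNeg.comp ((N.measurable_interference α).const_mul _)
    · exact fun l => ae_of_all _ fun ω => expNeg_le_one _
    · filter_upwards [hI] with ω hω
      have h1 : Tendsto (fun n : ℕ => ((n : ℝ≥0∞) + 1)⁻¹) atTop (nhds 0) := by
        have := (tendsto_add_atTop_iff_nat 1).2 ENNReal.tendsto_inv_nat_nhds_zero
        simpa using this
      have h2 := ENNReal.Tendsto.mul_const (b := N.interference α ω) h1 (Or.inr hω.ne)
      rw [zero_mul] at h2
      have h3 := (continuous_expNeg.tendsto 0).comp h2
      rwa [expNeg_zero] at h3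
  have h1 : 1 ≤ ∫⁻ x, expNeg (c x) ∂(P.map N.X0) := by
    have := le_of_tendsto' hlim hle
    simpa using this
  have h2 := ae_eq_of_ae_le_of_lintegral_le (μ := P.map N.X0) (f := fun x => expNeg (c x))
    (g := fun _ => 1) (ae_of_all _ fun x => expNeg_le_one _)
    (ne_top_of_le_ne_top ENNReal.one_ne_top
      ((lintegral_mono fun x => expNeg_le_one _).trans (by simp)))
    aemeasurable_const (by simpa using h1)
  filter_upwards [h2] with x hx j
  have h0 : c x = 0 := expNeg_eq_one_iff.1 hx
  exact (Finset.sum_eq_zero_iff.1 h0) j (Finset.mem_univ _)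

/-- The two conventions at the origin are reconciled: for each type, either the gain there is almost
surely zero or the intensity has no atom there. -/
theorem setLIntegral_expNeg_interference (N : PPPNetwork P J M θ) {α : ℝ} (hα : 0 < α)
    (hI : ∀ᵐ ω ∂P, N.interference α ω < ∞) {s : ℝ} (hs : 0 < s) {A : Set Plane}
    (hA : MeasurableSet A) :
    ∫⁻ ω in N.X0 ⁻¹' A, expNeg (ENNReal.ofReal s * N.interference α ω) ∂P =
      ∫⁻ x in A, expNeg (N.interferenceExponent α x s) ∂(P.map N.X0) := by
  rw [N.lintegral_expNeg_interference α _ hA]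
  refine lintegral_congr_ae ?_
  filter_upwards [ae_restrict_of_ae (N.ae_intensity_zero_mul hα hI)] with x hx
  congr 1
  refine Finset.sum_congr rfl fun j _ => lintegral_congr_ae ?_
  rcases mul_eq_zero.1 (hx j) with h | h
  · refine ae_of_all _ fun y => ?_
    by_cases hy : y = 0
    · subst hy
      have := N.isMarkovKernel_gainLaw j
      simp only [N.powerLaplace_zero hα j (ENNReal.ofReal_pos.2 hs).ne', h, norm_zero,
        Real.zero_rpow (neg_neg_of_pos hα).ne]
      simp
    · exact N.one_sub_powerLaplace α j hy hs.le
  · have : ∀ᵐ y ∂(N.intensity j x), y ≠ 0 := by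
      rw [ae_iff]
      simpa using h
    filter_upwards [this] with y hy
    exact N.one_sub_powerLaplace α j hy hs.le

/-- Where the exponent is infinite, e^{-sI} has integral zero, although it is positive wherever I <
∞; that event is therefore null. -/
theorem ae_interferenceExponent_lt_top (N : PPPNetwork P J M θ) {α : ℝ} (hα : 0 < α)
    (hI : ∀ᵐ ω ∂P, N.interference α ω < ∞) {s : ℝ} (hs : 0 < s) :
    ∀ᵐ ω ∂P, N.interferenceExponent α (N.X0 ω) s < ∞ := by
  have hA : MeasurableSet {x | N.interferenceExponent α x s = ∞} :=
    N.measurable_interferenceExponent α s (measurableSet_singleton _)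
  have h := N.setLIntegral_expNeg_interference hα hI hs hA
  rw [setLIntegral_congr_fun hA (g := fun _ => 0) fun x hx => by
    rw [show N.interferenceExponent α x s = ∞ from hx, expNeg_top]] at h
  rw [lintegral_zero, lintegral_eq_zero_iff
    (show Measurable fun ω => expNeg (ENNReal.ofReal s * N.interference α ω) from
      measurable_expNeg.comp ((N.measurable_interference α).const_mul _)),
    EventuallyEq, ae_restrict_iff' (N.measurable_X0 hA)] at h
  filter_upwards [h, hI] with ω h1 h2
  refine lt_top_iff_ne_top.2 fun h3 => ?_
  exact ENNReal.mul_ne_top ENNReal.ofReal_ne_top h2.ne (expNeg_eq_zero_iff.1 (h1 h3))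

end PPPNetwork

/-! ### Conditional law of noise plus interference given the distance -/

namespace PPPNetwork

variable {Ω : Type*} [MeasurableSpace Ω] {P : Measure Ω} {J : Type*} [Fintype J] {M : ℕ} {θ : ℝ}

/-- The denominator of the SINR as a real number. -/
noncomputable def noisePower (N : PPPNetwork P J M θ) (α noise : ℝ) (ω : Ω) : ℝ :=
  noise + (N.interference α ω).toReal

theorem measurable_noisePower (N : PPPNetwork P J M θ) (α noise : ℝ) :
    Measurable (N.noisePower α noise) :=
  (N.measurable_interference α).ennreal_toReal.const_add noise

theorem noisePower_nonneg (N : PPPNetwork P J M θ) (α : ℝ) {noise : ℝ} (hnoise : 0 ≤ noise)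
    (ω : Ω) : 0 ≤ N.noisePower α noise ω :=
  add_nonneg hnoise ENNReal.toReal_nonneg

theorem measurable_norm_X0 (N : PPPNetwork P J M θ) : Measurable fun ω => ‖N.X0 ω‖ :=
  N.measurable_X0.norm

variable [IsProbabilityMeasure P]

/-- The conditional Laplace transform of noise plus interference, in integrated form. -/
theorem setLIntegral_exp_noisePower (N : PPPNetwork P J M θ) {α : ℝ} (hα : 0 < α) {noise : ℝ}
    (hI : ∀ᵐ ω ∂P, N.interference α ω < ∞)
    (hrad : ∀ x x' : Plane, ‖x‖ = ‖x'‖ → ∀ s : ℝ, 0 < s →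
      N.interferenceExponent α x s = N.interferenceExponent α x' s)
    {s : ℝ} (hs : 0 < s) {A : Set Plane} (hA : MeasurableSet A) :
    ∫⁻ ω in N.X0 ⁻¹' A, ENNReal.ofReal (Real.exp (-s * N.noisePower α noise ω)) ∂P =
      ∫⁻ ω in N.X0 ⁻¹' A, ENNReal.ofReal (Real.exp (N.eta α noise ‖N.X0 ω‖ s)) ∂P := by
  have hL : ∀ᵐ ω ∂P, ENNReal.ofReal (Real.exp (-s * N.noisePower α noise ω)) =
      ENNReal.ofReal (Real.exp (-s * noise)) *
        expNeg (ENNReal.ofReal s * N.interference α ω) := by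
    filter_upwards [hI] with ω hω
    rw [expNeg_eq_ofReal (ENNReal.mul_ne_top ENNReal.ofReal_ne_top hω.ne),
      ← ENNReal.ofReal_mul (Real.exp_nonneg _), ← Real.exp_add, ENNReal.toReal_mul,
      ENNReal.toReal_ofReal hs.le, noisePower]
    congr 2
    ring
  have hR : ∀ᵐ ω ∂P, ENNReal.ofReal (Real.exp (N.eta α noise ‖N.X0 ω‖ s)) =
      ENNReal.ofReal (Real.exp (-s * noise)) *
        expNeg (N.interferenceExponent α (N.X0 ω) s) := by
    filter_upwards [N.ae_interferenceExponent_lt_top hα hI hs] with ω hω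
    rw [expNeg_eq_ofReal hω.ne, ← ENNReal.ofReal_mul (Real.exp_nonneg _), ← Real.exp_add, eta,
      N.interferenceExponent_single hrad _ hs]
    rfl
  rw [lintegral_congr_ae (ae_restrict_of_ae hL), lintegral_congr_ae (ae_restrict_of_ae hR),
    lintegral_const_mul' _ _ ENNReal.ofReal_ne_top, lintegral_const_mul' _ _ ENNReal.ofReal_ne_top,
    N.setLIntegral_expNeg_interference hα hI hs hA,
    setLIntegral_map hA (show Measurable fun x => expNeg (N.interferenceExponent α x s) from
      measurable_expNeg.comp (N.measurable_interferenceExponent α s)) N.measurable_X0]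

theorem condExp_exp_noisePower (N : PPPNetwork P J M θ) {α : ℝ} (hα : 0 < α) {noise : ℝ}
    (hnoise : 0 ≤ noise) (hI : ∀ᵐ ω ∂P, N.interference α ω < ∞)
    (hrad : ∀ x x' : Plane, ‖x‖ = ‖x'‖ → ∀ s : ℝ, 0 < s →
      N.interferenceExponent α x s = N.interferenceExponent α x' s)
    {s : ℝ} (hs : 0 < s) :
    P[fun ω => Real.exp (-s * N.noisePower α noise ω) |
        MeasurableSpace.comap N.X0 inferInstance]
      =ᵐ[P] fun ω => Real.exp (N.eta α noise ‖N.X0 ω‖ s) := by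
  have hm : MeasurableSpace.comap N.X0 inferInstance ≤ (inferInstance : MeasurableSpace Ω) :=
    N.measurable_X0.comap_le
  have hVm : Measurable fun ω => Real.exp (-s * N.noisePower α noise ω) :=
    ((N.measurable_noisePower α noise).const_mul _).exp
  have hgm : Measurable fun x : Plane => Real.exp (N.eta α noise ‖x‖ s) :=
    ((N.measurable_eta α noise s).comp measurable_norm).exp
  have hgm' : Measurable fun ω => Real.exp (N.eta α noise ‖N.X0 ω‖ s) :=
    hgm.comp N.measurable_X0
  have hg : Integrable (fun ω => Real.exp (N.eta α noise ‖N.X0 ω‖ s)) P := by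
    refine Integrable.mono' (integrable_const (1 : ℝ)) hgm'.aestronglyMeasurable
      (ae_of_all _ fun ω => ?_)
    rw [Real.norm_of_nonneg (Real.exp_nonneg _), Real.exp_le_one_iff]
    exact N.eta_nonpos α hnoise _ hs
  have hf : Integrable (fun ω => Real.exp (-s * N.noisePower α noise ω)) P := by
    refine Integrable.mono' (integrable_const (1 : ℝ)) hVm.aestronglyMeasurable
      (ae_of_all _ fun ω => ?_)
    rw [Real.norm_of_nonneg (Real.exp_nonneg _), Real.exp_le_one_iff, neg_mul]
    exact neg_nonpos.2 (mul_nonneg hs.le (N.noisePower_nonneg α hnoise ω))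
  refine (ae_eq_condExp_of_forall_setIntegral_eq hm hf (fun _ _ _ => hg.integrableOn) ?_ ?_).symm
  · rintro _ ⟨A, hA, rfl⟩ _
    rw [integral_eq_lintegral_of_nonneg_ae (ae_of_all _ fun _ => Real.exp_nonneg _)
      hgm'.aestronglyMeasurable, integral_eq_lintegral_of_nonneg_ae
      (ae_of_all _ fun _ => Real.exp_nonneg _) hVm.aestronglyMeasurable,
      N.setLIntegral_exp_noisePower hα hI hrad hs hA]
  · exact (hgm.comp (comap_measurable N.X0)).stronglyMeasurable.aestronglyMeasurable

/-- The conditional distribution of noise plus interference given the distance of the associated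
transmitter. -/
noncomputable def noisePowerLaw (N : PPPNetwork P J M θ) (α noise : ℝ) : Kernel ℝ ℝ :=
  condDistrib (N.noisePower α noise) (fun ω => ‖N.X0 ω‖) P

instance (N : PPPNetwork P J M θ) (α noise : ℝ) : IsMarkovKernel (N.noisePowerLaw α noise) := by
  unfold noisePowerLaw
  infer_instance

theorem compProd_noisePowerLaw (N : PPPNetwork P J M θ) (α noise : ℝ) :
    (P.map fun ω => ‖N.X0 ω‖) ⊗ₘ N.noisePowerLaw α noise =
      P.map fun ω => (‖N.X0 ω‖, N.noisePower α noise ω) :=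
  compProd_map_condDistrib (N.measurable_noisePower α noise).aemeasurable

theorem ae_noisePowerLaw_nonneg (N : PPPNetwork P J M θ) (α : ℝ) {noise : ℝ}
    (hnoise : 0 ≤ noise) :
    ∀ᵐ r ∂(P.map fun ω => ‖N.X0 ω‖), ∀ᵐ v ∂(N.noisePowerLaw α noise r), 0 ≤ v := by
  refine Measure.ae_ae_of_ae_compProd (p := fun x : ℝ × ℝ => 0 ≤ x.2) ?_
  rw [N.compProd_noisePowerLaw, ae_map_iff
    (N.measurable_norm_X0.prodMk (N.measurable_noisePower α noise)).aemeasurable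
    (measurableSet_le measurable_const measurable_snd)]
  exact ae_of_all _ fun ω => N.noisePower_nonneg α hnoise ω

/-- Disintegration of the integrated identity over the events ‖X₀‖ ∈ B. The exceptional null set
still depends on s. -/
theorem ae_lintegral_noisePowerLaw (N : PPPNetwork P J M θ) {α : ℝ} (hα : 0 < α) {noise : ℝ}
    (hI : ∀ᵐ ω ∂P, N.interference α ω < ∞)
    (hrad : ∀ x x' : Plane, ‖x‖ = ‖x'‖ → ∀ s : ℝ, 0 < s →
      N.interferenceExponent α x s = N.interferenceExponent α x' s)
    {s : ℝ} (hs : 0 < s) :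
    ∀ᵐ r ∂(P.map fun ω => ‖N.X0 ω‖),
      ∫⁻ v, ENNReal.ofReal (Real.exp (-s * v)) ∂(N.noisePowerLaw α noise r) =
        ENNReal.ofReal (Real.exp (N.eta α noise r s)) := by
  have : IsProbabilityMeasure (P.map fun ω => ‖N.X0 ω‖) :=
    Measure.isProbabilityMeasure_map N.measurable_norm_X0.aemeasurable
  have hem : Measurable fun v : ℝ => ENNReal.ofReal (Real.exp (-s * v)) := by fun_prop
  have hm : Measurable fun r => ENNReal.ofReal (Real.exp (N.eta α noise r s)) :=
    (N.measurable_eta α noise s).exp.ennreal_ofReal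
  refine ae_eq_of_forall_setLIntegral_eq_of_sigmaFinite hem.lintegral_kernel hm
    fun B hB _ => ?_
  have h1 := Measure.setLIntegral_compProd (μ := P.map fun ω => ‖N.X0 ω‖)
    (κ := N.noisePowerLaw α noise) (hem.comp measurable_snd) hB MeasurableSet.univ
  simp only [Measure.restrict_univ, Function.comp_def] at h1
  rw [← h1, N.compProd_noisePowerLaw, setLIntegral_map (hB.prod MeasurableSet.univ)
    (show Measurable fun x : ℝ × ℝ => ENNReal.ofReal (Real.exp (-s * x.2)) from
      hem.comp measurable_snd) (N.measurable_norm_X0.prodMk (N.measurable_noisePower α noise)),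
    setLIntegral_map hB hm N.measurable_norm_X0]
  have h2 := N.setLIntegral_exp_noisePower (noise := noise) hα hI hrad hs (measurable_norm hB)
  rw [show (fun ω => (‖N.X0 ω‖, N.noisePower α noise ω)) ⁻¹' B ×ˢ univ =
    N.X0 ⁻¹' (norm ⁻¹' B) by ext; simp]
  exact h2

/-- For almost every distance `r`, `exp (η_r)` is the Laplace transform of the conditional law of
noise plus interference, at all points simultaneously. -/
theorem ae_forall_integral_noisePowerLaw (N : PPPNetwork P J M θ) {α : ℝ} (hα : 0 < α) {noise : ℝ}
    (hnoise : 0 ≤ noise) (hI : ∀ᵐ ω ∂P, N.interference α ω < ∞)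
    (hrad : ∀ x x' : Plane, ‖x‖ = ‖x'‖ → ∀ s : ℝ, 0 < s →
      N.interferenceExponent α x s = N.interferenceExponent α x' s) :
    ∀ᵐ r ∂(P.map fun ω => ‖N.X0 ω‖), ∀ s, 0 < s →
      ∫ v, Real.exp (-s * v) ∂(N.noisePowerLaw α noise r) = Real.exp (N.eta α noise r s) := by
  have hQ : ∀ᵐ r ∂(P.map fun ω => ‖N.X0 ω‖), ∀ q : ℚ, (0 : ℝ) < q →
      N.interferenceExponent α (EuclideanSpace.single 0 r) q < ∞ ∧
      ∫⁻ v, ENNReal.ofReal (Real.exp (-(q : ℝ) * v)) ∂(N.noisePowerLaw α noise r) =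
        ENNReal.ofReal (Real.exp (N.eta α noise r q)) := by
    rw [ae_all_iff]
    intro q
    by_cases hq : (0 : ℝ) < q
    swap
    · exact ae_of_all _ fun r h => absurd h hq
    have hD : ∀ᵐ r ∂(P.map fun ω => ‖N.X0 ω‖),
        N.interferenceExponent α (EuclideanSpace.single 0 r) q < ∞ := by
      rw [ae_map_iff N.measurable_norm_X0.aemeasurable]
      · filter_upwards [N.ae_interferenceExponent_lt_top hα hI hq] with ω hω
        rwa [N.interferenceExponent_single hrad _ hq]
      · exact measurableSet_lt ((N.measurable_interferenceExponent α q).comp measurable_single)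
          measurable_const
    filter_upwards [hD, N.ae_lintegral_noisePowerLaw (noise := noise) hα hI hrad hq] with r h1 h2 _
    exact ⟨h1, h2⟩
  filter_upwards [hQ, N.ae_noisePowerLaw_nonneg α hnoise] with r hr hpos
  have hfin : ∀ s, 0 < s → N.interferenceExponent α (EuclideanSpace.single 0 r) s < ∞ := by
    intro s hs
    obtain ⟨q, hq⟩ := exists_rat_gt s
    exact (N.interferenceExponent_mono α _ hs.le hq.le).trans_lt (hr q (hs.trans hq)).1
  have hL : ∀ q : ℚ, (0 : ℝ) < q → mgf id (N.noisePowerLaw α noise r) (-(q : ℝ)) =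
      Real.exp (N.eta α noise r q) := by
    intro q hq
    have h := (hr q hq).2
    rw [mgf, integral_eq_lintegral_of_nonneg_ae (ae_of_all _ fun _ => Real.exp_nonneg _)
      (by fun_prop)]
    simp only [id]
    rw [h, ENNReal.toReal_ofReal (Real.exp_nonneg _)]
  intro s hs
  have hcont := (analyticAt_laplace hpos hs).continuousAt
  change mgf id (N.noisePowerLaw α noise r) (-s) = _
  -- Both sides agree at positive rationals. The left side is continuous and the right side
  -- antitone, so a strict inequality at s is contradicted at a nearby rational, above s in one case
  -- and below s in the other.
  refine le_antisymm (le_of_not_gt fun hlt => ?_) (le_of_not_gt fun hlt => ?_)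
  · have hev := hcont.eventually (lt_mem_nhds hlt)
    obtain ⟨l, u, hlu, hsub⟩ := mem_nhds_iff_exists_Ioo_subset.1 hev
    obtain ⟨q, hq1, hq2⟩ := exists_rat_btwn hlu.2
    have h1 : Real.exp (N.eta α noise r s) < mgf id (N.noisePowerLaw α noise r) (-(q : ℝ)) :=
      hsub ⟨hlu.1.trans hq1, hq2⟩
    rw [hL q (hs.trans hq1), Real.exp_lt_exp] at h1
    exact absurd (N.eta_antitone hnoise hfin hs hq1.le) (not_le.2 h1)
  · have hev := hcont.eventually (gt_mem_nhds hlt)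
    obtain ⟨l, u, hlu, hsub⟩ := mem_nhds_iff_exists_Ioo_subset.1 hev
    obtain ⟨q, hq1, hq2⟩ := exists_rat_btwn (max_lt hlu.1 hs)
    have hq0 : (0 : ℝ) < q := (le_max_right _ _).trans_lt hq1
    have h1 : mgf id (N.noisePowerLaw α noise r) (-(q : ℝ)) < Real.exp (N.eta α noise r s) :=
      hsub ⟨(le_max_left _ _).trans_lt hq1, hq2.trans hlu.2⟩
    rw [hL q hq0, Real.exp_lt_exp] at h1
    exact absurd (N.eta_antitone hnoise hfin hq0 hq2.le) (not_le.2 h1)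

end PPPNetwork

/-! ### Coverage given the distance -/

namespace PPPNetwork

variable {Ω : Type*} [MeasurableSpace Ω] {P : Measure Ω} {J : Type*} [Fintype J] {M : ℕ} {θ : ℝ}

/-- The signal gain is independent of the distance and of noise plus interference. -/
theorem indepFun_norm_noisePower (N : PPPNetwork P J M θ) (α noise : ℝ) :
    IndepFun (fun ω => (‖N.X0 ω‖, N.noisePower α noise ω)) N.g0 P := by
  let sel : Plane × (J → ℕ∞) × (J → ℕ → Plane) × (J → ℕ → ℝ≥0) → ℝ × ℝ := fun z =>
    (‖z.1‖, noise + (∑ j, ∑' n : ℕ, if (n : ℕ∞) < z.2.1 j then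
      (z.2.2.2 j n : ℝ≥0∞) * ‖z.2.2.1 j n‖ₑ ^ (-α) else 0).toReal)
  have h_sel : Measurable sel := by
    refine measurable_fst.norm.prodMk (Measurable.const_add (Measurable.ennreal_toReal ?_) _)
    refine Finset.measurable_sum _ fun j _ => Measurable.tsum fun n => ?_
    refine Measurable.ite ?_ (by fun_prop) measurable_const
    exact (show Measurable fun z : Plane × (J → ℕ∞) × (J → ℕ → Plane) × (J → ℕ → ℝ≥0) => z.2.1 j
      by fun_prop) (Set.to_countable (Ioi (n : ℕ∞))).measurableSet
  exact (N.g0_indep.comp measurable_id h_sel).symm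

/-- A vanishing denominator is no exception: a/0 = ∞ for a > 0 and 0/0 = 0, while γ is finite. -/
theorem lt_sinr_iff (N : PPPNetwork P J M θ) {α noise γ : ℝ} (hnoise : 0 ≤ noise) (hγ : 0 < γ)
    {ω : Ω} (hI : N.interference α ω < ∞) (hX : 0 < ‖N.X0 ω‖) :
    ENNReal.ofReal γ < N.sinr α noise ω ↔
      γ * ‖N.X0 ω‖ ^ α * N.noisePower α noise ω < N.g0 ω := by
  have hden : ENNReal.ofReal noise + N.interference α ω =
      ENNReal.ofReal (N.noisePower α noise ω) := by
    rw [noisePower, ENNReal.ofReal_add hnoise ENNReal.toReal_nonneg, ENNReal.ofReal_toReal hI.ne]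
  have hV := N.noisePower_nonneg α hnoise ω
  have hXα : 0 < ‖N.X0 ω‖ ^ α := Real.rpow_pos_of_pos hX α
  rw [sinr, hden, ENNReal.lt_div_iff_mul_lt (Or.inr ENNReal.ofReal_ne_top)
    (Or.inl ENNReal.ofReal_ne_top), ← ENNReal.ofReal_mul hγ.le,
    ENNReal.ofReal_lt_ofReal_iff_of_nonneg (mul_nonneg hγ.le hV), Real.rpow_neg hX.le,
    ← div_eq_mul_inv, lt_div_iff₀ hXα, mul_right_comm]

variable [IsProbabilityMeasure P]

/-- The coverage probability given the distance of the associated transmitter. -/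
noncomputable def condCoverage (N : PPPNetwork P J M θ) (α noise γ r : ℝ) : ℝ≥0∞ :=
  ∫⁻ v, P.map N.g0 (Ioi (γ * r ^ α * v)) ∂(N.noisePowerLaw α noise r)

theorem measurable_map_Ioi (N : PPPNetwork P J M θ) (α γ : ℝ) :
    Measurable fun x : ℝ × ℝ => P.map N.g0 (Ioi (γ * x.1 ^ α * x.2)) :=
  measurable_measure_prodMk_left (ν := P.map N.g0)
    (s := {z : (ℝ × ℝ) × ℝ | γ * z.1.1 ^ α * z.1.2 < z.2})
    (measurableSet_lt (by fun_prop) (by fun_prop))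

theorem measurable_condCoverage (N : PPPNetwork P J M θ) (α noise γ : ℝ) :
    Measurable (N.condCoverage α noise γ) :=
  (N.measurable_map_Ioi α γ).lintegral_kernel_prod_right'

theorem condCoverage_le_one (N : PPPNetwork P J M θ) (α noise γ r : ℝ) :
    N.condCoverage α noise γ r ≤ 1 := by
  have : IsProbabilityMeasure (P.map N.g0) :=
    Measure.isProbabilityMeasure_map N.measurable_g0.aemeasurable
  exact (lintegral_mono fun v => prob_le_one).trans (by simp)

theorem coverageProb_eq_integral_condCoverage (N : PPPNetwork P J M θ) {α noise γ : ℝ}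
    (hnoise : 0 ≤ noise) (hγ : 0 < γ) (hI : ∀ᵐ ω ∂P, N.interference α ω < ∞)
    (hX : ∀ᵐ r ∂(P.map fun ω => ‖N.X0 ω‖), 0 < r) :
    N.coverageProb α noise γ =
      ∫ r, (N.condCoverage α noise γ r).toReal ∂(P.map fun ω => ‖N.X0 ω‖) := by
  have hRV : Measurable fun ω => (‖N.X0 ω‖, N.noisePower α noise ω) :=
    N.measurable_norm_X0.prodMk (N.measurable_noisePower α noise)
  have hT : MeasurableSet {z : (ℝ × ℝ) × ℝ | γ * z.1.1 ^ α * z.1.2 < z.2} :=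
    measurableSet_lt (by fun_prop) (by fun_prop)
  have h1 : P {ω | ENNReal.ofReal γ < N.sinr α noise ω} =
      P {ω | γ * ‖N.X0 ω‖ ^ α * N.noisePower α noise ω < N.g0 ω} := by
    refine measure_congr ?_
    filter_upwards [hI, ae_of_ae_map N.measurable_norm_X0.aemeasurable hX] with ω h1 h2
    exact propext (N.lt_sinr_iff hnoise hγ h1 h2)
  have h2 : P {ω | γ * ‖N.X0 ω‖ ^ α * N.noisePower α noise ω < N.g0 ω} =
      ∫⁻ r, N.condCoverage α noise γ r ∂(P.map fun ω => ‖N.X0 ω‖) := by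
    have h3 := (indepFun_iff_map_prod_eq_prod_map_map hRV.aemeasurable
      N.measurable_g0.aemeasurable).1 (N.indepFun_norm_noisePower α noise)
    have h4 := Measure.ext_iff.1 h3 _ hT
    rw [Measure.map_apply (hRV.prodMk N.measurable_g0) hT, Measure.prod_apply hT,
      ← N.compProd_noisePowerLaw,
      Measure.lintegral_compProd (measurable_measure_prodMk_left hT)] at h4
    exact h4
  rw [coverageProb, measureReal_def, h1, h2, integral_toReal
    (N.measurable_condCoverage α noise γ).aemeasurable
    (ae_of_all _ fun r => (N.condCoverage_le_one α noise γ r).trans_lt ENNReal.one_lt_top)]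

/-- The Gamma tail with rate θ⁻¹ at γ r^α v is the truncated Poisson sum at sv, whose average over
the law of V is the matrix norm. -/
theorem ae_toReal_condCoverage_eq (N : PPPNetwork P J M θ) (hM : 0 < M) (hθ : 0 < θ) {α : ℝ}
    (hα : 0 < α) {noise : ℝ} (hnoise : 0 ≤ noise) {γ : ℝ} (hγ : 0 < γ)
    (hI : ∀ᵐ ω ∂P, N.interference α ω < ∞)
    (hrad : ∀ x x' : Plane, ‖x‖ = ‖x'‖ → ∀ s : ℝ, 0 < s →
      N.interferenceExponent α x s = N.interferenceExponent α x' s)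
    (hX : ∀ᵐ r ∂(P.map fun ω => ‖N.X0 ω‖), 0 < r) :
    ∀ᵐ r ∂(P.map fun ω => ‖N.X0 ω‖), (N.condCoverage α noise γ r).toReal =
      inducedL1Norm (NormedSpace.exp
        (lowerToeplitz M (toeplitzCoeff (N.eta α noise r) (γ * r ^ α / θ)))) := by
  filter_upwards [hX, N.ae_noisePowerLaw_nonneg α hnoise,
    N.ae_forall_integral_noisePowerLaw hα hnoise hI hrad] with r hr hpos hL
  have hs : 0 < γ * r ^ α / θ := div_pos (mul_pos hγ (Real.rpow_pos_of_pos hr α)) hθ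
  rw [inducedL1Norm_exp_lowerToeplitz hM hpos hL hs, integral_eq_lintegral_of_nonneg_ae,
    condCoverage, N.g0_law]
  · congr 1
    refine lintegral_congr_ae ?_
    filter_upwards [hpos] with v hv
    rw [gammaMeasure_Ioi hM (inv_pos.2 hθ)
      (mul_nonneg (mul_pos hγ (Real.rpow_pos_of_pos hr α)).le hv)]
    have e : θ⁻¹ * (γ * r ^ α * v) = γ * r ^ α / θ * v := by ring
    rw [e]
  · filter_upwards [hpos] with v hv
    have := mul_nonneg hs.le hv
    exact Finset.sum_nonneg fun k _ => by positivity
  · exact Continuous.aestronglyMeasurable (by fun_prop)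

end PPPNetwork

/-! ### Integration over the distance -/

theorem theorem1 {Ω : Type*} [MeasurableSpace Ω] (P : Measure Ω) [IsProbabilityMeasure P]
    {J : Type*} [Fintype J] (M : ℕ) (hM : 0 < M) (θ : ℝ) (hθ : 0 < θ)
    (N : PPPNetwork P J M θ)
    (α : ℝ) (hα : 0 < α) (noise : ℝ) (hnoise : 0 ≤ noise) (γ : ℝ) (hγ : 0 < γ)
    -- `f` is the pdf of the distance `r₀ = ‖x₀‖`
    (f : ℝ → ℝ) (hf_meas : Measurable f) (hf_nonneg : ∀ r, 0 ≤ f r)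
    (hf : P.map (fun ω => ‖N.X0 ω‖) = volume.withDensity (fun r => ENNReal.ofReal (f r)))
    -- the aggregate interference is almost surely finite
    (hI : ∀ᵐ ω ∂P, N.interference α ω < ∞)
    -- the Laplace exponent depends on `x₀` only through the distance `‖x₀‖`
    (hrad : ∀ x x' : Plane, ‖x‖ = ‖x'‖ → ∀ s : ℝ, 0 < s →
      N.interferenceExponent α x s = N.interferenceExponent α x' s) :
    -- `exp (η (s))` is the conditional Laplace transform of noise plus interference
    (∀ s : ℝ, 0 < s →
      P[fun ω => Real.exp (-s * (noise + (N.interference α ω).toReal)) |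
          MeasurableSpace.comap N.X0 inferInstance]
        =ᵐ[P] fun ω => Real.exp (N.eta α noise ‖N.X0 ω‖ s)) ∧
    -- `η` is smooth, so that its derivatives are genuine
    (∀ᵐ ω ∂P, ContDiffOn ℝ ((⊤ : ℕ∞) : WithTop ℕ∞) (N.eta α noise ‖N.X0 ω‖) (Ioi 0)) ∧
    IntegrableOn (fun r => f r * inducedL1Norm (NormedSpace.exp
      (lowerToeplitz M (toeplitzCoeff (N.eta α noise r) (γ * r ^ α / θ))))) (Ioi 0) ∧
    N.coverageProb α noise γ = ∫ r in Ioi (0 : ℝ), f r * inducedL1Norm (NormedSpace.exp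
      (lowerToeplitz M (toeplitzCoeff (N.eta α noise r) (γ * r ^ α / θ)))) := by
  have : IsProbabilityMeasure (P.map fun ω => ‖N.X0 ω‖) :=
    Measure.isProbabilityMeasure_map N.measurable_norm_X0.aemeasurable
  have hX : ∀ᵐ r ∂(P.map fun ω => ‖N.X0 ω‖), 0 < r := by
    have h0 : ∀ᵐ r ∂(P.map fun ω => ‖N.X0 ω‖), r ≠ 0 := by
      rw [hf]
      exact (withDensity_absolutelyContinuous _ _).ae_le (Measure.ae_ne volume 0)
    have h1 : ∀ᵐ r ∂(P.map fun ω => ‖N.X0 ω‖), 0 ≤ r := by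
      rw [ae_map_iff N.measurable_norm_X0.aemeasurable measurableSet_Ici]
      exact ae_of_all _ fun ω => norm_nonneg _
    filter_upwards [h0, h1] with r h0 h1
    exact lt_of_le_of_ne h1 h0.symm
  refine ⟨fun s hs => N.condExp_exp_noisePower hα hnoise hI hrad hs, ?_, ?_⟩
  · refine ae_of_ae_map N.measurable_norm_X0.aemeasurable
      (p := fun r => ContDiffOn ℝ ((⊤ : ℕ∞) : WithTop ℕ∞) (N.eta α noise r) (Ioi 0)) ?_
    filter_upwards [N.ae_noisePowerLaw_nonneg α hnoise,
      N.ae_forall_integral_noisePowerLaw hα hnoise hI hrad] with r hpos hL s hs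
    exact (analyticAt_of_exp_eq_laplace hpos hL hs).contDiffAt.contDiffWithinAt
  · have hfm : Measurable fun r => ENNReal.ofReal (f r) := hf_meas.ennreal_ofReal
    have hft : ∀ᵐ r ∂(volume : Measure ℝ), ENNReal.ofReal (f r) < ∞ :=
      ae_of_all _ fun r => ENNReal.ofReal_lt_top
    have hKint : Integrable (fun r => (N.condCoverage α noise γ r).toReal)
        (P.map fun ω => ‖N.X0 ω‖) := by
      refine Integrable.mono' (integrable_const (1 : ℝ))
        (N.measurable_condCoverage α noise γ).ennreal_toReal.aestronglyMeasurable
        (ae_of_all _ fun r => ?_)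
      rw [Real.norm_of_nonneg ENNReal.toReal_nonneg]
      exact ENNReal.toReal_le_of_le_ofReal zero_le_one
        (by simpa using N.condCoverage_le_one α noise γ r)
    have hae := N.ae_toReal_condCoverage_eq hM hθ hα hnoise hγ hI hrad hX
    have hcov := N.coverageProb_eq_integral_condCoverage hnoise hγ hI hX
    rw [hf] at hX hKint hae hcov
    rw [ae_withDensity_iff hfm] at hX hae
    rw [integrable_withDensity_iff_integrable_smul' hfm hft] at hKint
    rw [integral_withDensity_eq_integral_toReal_smul hfm hft] at hcov
    simp only [ENNReal.toReal_ofReal (hf_nonneg _), smul_eq_mul] at hKint hcov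
    have hfz : ∀ r, ¬ENNReal.ofReal (f r) ≠ 0 → f r = 0 := fun r h =>
      le_antisymm (ENNReal.ofReal_eq_zero.1 (not_not.1 h)) (hf_nonneg r)
    -- The formula for the conditional coverage is known only for almost every r with f(r) ≠ 0;
    -- elsewhere the factor f(r) makes both sides zero.
    have heq : (fun r => f r * (N.condCoverage α noise γ r).toReal) =ᵐ[volume]
        fun r => f r * inducedL1Norm (NormedSpace.exp
          (lowerToeplitz M (toeplitzCoeff (N.eta α noise r) (γ * r ^ α / θ)))) := by
      filter_upwards [hae] with r hr
      by_cases h : ENNReal.ofReal (f r) ≠ 0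
      · rw [hr h]
      · rw [hfz r h, zero_mul, zero_mul]
    refine ⟨(hKint.congr heq).integrableOn, ?_⟩
    -- Since r₀ > 0 almost surely, f vanishes almost everywhere on (-∞, 0].
    rw [hcov, integral_congr_ae heq, setIntegral_eq_integral_of_ae_compl_eq_zero]
    filter_upwards [hX] with r hr hr0
    rw [hfz r fun h => hr0 (hr h), zero_mul]
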